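/- Let $\theta\neq 2$ be a Pisot number, that is, a real algebraic integer $\theta>1$ all of whose other Galois conjugates have modulus less than $1$. Let $\mu_\theta$ be the Bernoulli convolution with parameter $\theta$, the infinite convolution of the measures $\frac12\delta_{-\theta^{-k}}+\frac12\delta_{\theta^{-k}}$, $k=0,1,2,\dots$ (equivalently, the law of the random series $\sum_{k\ge 0}\pm\theta^{-k}$ with independent fair signs), and let $\widehat{\mu_\theta}(t)=\int_{\mathbb R} e^{-2\pi i t x}\,d\mu_\theta(x)$ for $t\in\mathbb R$. For $r>0$ put $\mathcal F_r=\{\widehat{\mu_\theta}(rn): n\in\mathbb Z\}$, and let $\mathcal F_r'$ denote the derived set of $\mathcal F_r$, i.e. the set of its accumulation points. Then: (i) for every positive $r\in\mathbb Q(\theta)$, the set $\mathcal F_r'$ is countably infinite; (ii) the set $J_\theta$ of limit points of $\widehat{\mu_\theta}(t)$ as $t\to+\infty$ along the reals is a non-degenerate compact interval $[a,b]\subset\mathbb R$, $a<b$, and $\mathcal F_r'=J_\theta$ for Lebesgue-almost every $r>0$. -/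

import Mathlib

open MeasureTheory Set Filter Topology
open scoped ENNReal

/-- A Pisot number: a real algebraic integer `θ > 1` all of whose other Galois conjugates
(complex roots of its minimal polynomial over `ℚ`) have modulus less than `1`. -/
def IsPisot (θ : ℝ) : Prop :=
  1 < θ ∧ IsIntegral ℤ θ ∧
    ∀ z : ℂ, Polynomial.aeval z (minpoly ℚ θ) = 0 → z ≠ (θ : ℂ) → ‖z‖ < 1

/-- The symmetric two-point measure `(1/2) δ_{-x} + (1/2) δ_x`. -/
noncomputable def twoPoint (x : ℝ) : Measure ℝ :=
  (2⁻¹ : ℝ≥0∞) • Measure.dirac (-x) + (2⁻¹ : ℝ≥0∞) • Measure.dirac x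

instance twoPoint_isProbabilityMeasure (x : ℝ) : IsProbabilityMeasure (twoPoint x) :=
  ⟨by simp [twoPoint, ENNReal.inv_two_add_inv_two]⟩

/-- The infinite convolution `ν 0 * ν 1 * ν 2 * ⋯` of probability measures on the line: the law of
the sum of a sequence of independent random variables with laws `ν k` (meant for families for which
this random series converges almost surely). -/
noncomputable def infiniteConvolution (ν : ℕ → Measure ℝ) [∀ k, IsProbabilityMeasure (ν k)] :
    Measure ℝ :=
  (Measure.infinitePi ν).map (fun x : ℕ → ℝ => ∑' k, x k)

/-- The Bernoulli convolution `μ_θ`: the infinite convolution of the measures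
`(1/2) δ_{-θ^{-k}} + (1/2) δ_{θ^{-k}}`, `k = 0, 1, 2, …`. -/
noncomputable def bernoulliConvolution (θ : ℝ) : Measure ℝ :=
  infiniteConvolution (fun k : ℕ => twoPoint ((θ ^ k)⁻¹))

/-- The Fourier transform of a measure on the line, `t ↦ ∫ exp (-2πi t x) dμ(x)`. -/
noncomputable def fourierTransform (μ : Measure ℝ) (t : ℝ) : ℂ :=
  ∫ x : ℝ, Complex.exp (-2 * Real.pi * Complex.I * t * x) ∂μ

/-- The set `{μ̂(r n) : n ∈ ℤ}`. -/
def fourierValues (μ : Measure ℝ) (r : ℝ) : Set ℂ :=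
  Set.range (fun n : ℤ => fourierTransform μ (r * n))

/-- The set of limit points of `μ̂(t)` as `t → +∞` along the reals. -/
def fourierLimitPoints (μ : Measure ℝ) : Set ℂ :=
  {z : ℂ | MapClusterPt z atTop (fourierTransform μ)}

/-! The Fourier transform of the Bernoulli convolution is `t ↦ ∏ cos (2π t θ⁻ᵏ)`. If `ξ θᵏ` is
summably close to the integers as `k → ∞`, its values along `ξ θᴺ` tend to the two-sided product
over `ξ θᵏ`, `k : ℤ`. Perturbing `ξ` by its own far translates gives limits accumulating at the
powers of a two-sided product `w` with `0 < |w| < 1`, so for `r ∈ ℚ(θ)` the derived set is infinite.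

For countability, write `t θ⁻ᵏ` modulo `1 / 2` as a bounded sequence. A lower bound on the product
bounds its square sum, and for `t` in a fixed fractional ideal the integer recurrence satisfied by
`θ⁻ᵏ` turns it into an integer sequence of bounded `ℓ¹` norm, from which it is recovered by
convolution with a summable Green function. As such integer sequences vary, they split into a
bounded number of fixed finite blocks drifting apart, and the product splits into the corresponding
factors, so only countably many limits occur.

Along the reals the limit points form an interval, by the intermediate value theorem. If `t_j → ∞`
with values tending to a limit point, then for almost every `u` the numbers `u t_j` come arbitrarily
close to integers, because the limsup of thickenings of `t_j⁻¹ ℤ` is unchanged almost everywhere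
when the radii are rescaled. With `r = u⁻¹` some `r n` is therefore close to some `t_j`. -/

open scoped Real

/-! ### Infinite products of elements of norm at most one -/

section Products

variable {ι R 𝕜 : Type*}

theorem norm_prod_sub_prod_le [NormedCommRing R] [NormOneClass R] (s : Finset ι) {f g : ι → R}
    (hf : ∀ i ∈ s, ‖f i‖ ≤ 1) (hg : ∀ i ∈ s, ‖g i‖ ≤ 1) :
    ‖∏ i ∈ s, f i - ∏ i ∈ s, g i‖ ≤ ∑ i ∈ s, ‖f i - g i‖ := by
  classical
  induction s using Finset.induction_on with
  | empty => simp
  | insert a s ha ih =>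
    rw [Finset.forall_mem_insert] at hf hg
    rw [Finset.prod_insert ha, Finset.prod_insert ha, Finset.sum_insert ha]
    have hprod : ‖∏ i ∈ s, f i‖ ≤ 1 :=
      (s.norm_prod_le f).trans (Finset.prod_le_one (fun _ _ => norm_nonneg _) hf.2)
    calc ‖f a * ∏ i ∈ s, f i - g a * ∏ i ∈ s, g i‖
        = ‖(f a - g a) * ∏ i ∈ s, f i + g a * (∏ i ∈ s, f i - ∏ i ∈ s, g i)‖ := by
          congr 1; ring
      _ ≤ ‖f a - g a‖ * ‖∏ i ∈ s, f i‖ + ‖g a‖ * ‖∏ i ∈ s, f i - ∏ i ∈ s, g i‖ :=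
          (norm_add_le _ _).trans (add_le_add (norm_mul_le _ _) (norm_mul_le _ _))
      _ ≤ ‖f a - g a‖ + ∑ i ∈ s, ‖f i - g i‖ :=
          add_le_add (mul_le_of_le_one_right (norm_nonneg _) hprod)
            ((mul_le_of_le_one_left (norm_nonneg _) hg.1).trans (ih hf.2 hg.2))

theorem norm_tprod_sub_tprod_le [NormedCommRing R] [NormOneClass R] {f g : ι → R}
    (hfm : Multipliable f) (hgm : Multipliable g) (hf : ∀ i, ‖f i‖ ≤ 1) (hg : ∀ i, ‖g i‖ ≤ 1)
    (h : Summable fun i => ‖f i - g i‖) :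
    ‖∏' i, f i - ∏' i, g i‖ ≤ ∑' i, ‖f i - g i‖ :=
  le_of_tendsto_of_tendsto' (hfm.hasProd.sub hgm.hasProd).norm h.hasSum fun s =>
    norm_prod_sub_prod_le s (fun i _ => hf i) fun i _ => hg i

variable [NormedField 𝕜] {f g : ι → 𝕜}

theorem norm_tprod_le_mul_norm_tprod (hfm : Multipliable f) (hgm : Multipliable g)
    (hfg : ∀ i, ‖f i‖ ≤ ‖g i‖) {ρ : ℝ} (j : ι) (hj : ‖f j‖ ≤ ρ * ‖g j‖) :
    ‖∏' i, f i‖ ≤ ρ * ‖∏' i, g i‖ := by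
  classical
  refine le_of_tendsto_of_tendsto hfm.hasProd.norm (hgm.hasProd.norm.const_mul ρ) ?_
  filter_upwards [eventually_ge_atTop {j}] with s hs
  have hjs : j ∈ s := hs (Finset.mem_singleton_self j)
  rw [← Finset.mul_prod_erase s (fun i => ‖f i‖) hjs,
    ← Finset.mul_prod_erase s (fun i => ‖g i‖) hjs, ← mul_assoc]
  exact mul_le_mul hj (Finset.prod_le_prod (fun _ _ => norm_nonneg _) fun i _ => hfg i)
    (Finset.prod_nonneg fun _ _ => norm_nonneg _) ((norm_nonneg _).trans hj)

theorem norm_tprod_lt_norm_tprod (hfm : Multipliable f) (hgm : Multipliable g)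
    (hfg : ∀ i, ‖f i‖ ≤ ‖g i‖) {j : ι} (hj : ‖f j‖ < ‖g j‖) (hg : ∏' i, g i ≠ 0) :
    ‖∏' i, f i‖ < ‖∏' i, g i‖ := by
  have hgj : 0 < ‖g j‖ := (norm_nonneg _).trans_lt hj
  refine (norm_tprod_le_mul_norm_tprod hfm hgm hfg j (ρ := ‖f j‖ / ‖g j‖)
    (div_mul_cancel₀ _ hgj.ne').ge).trans_lt ?_
  exact mul_lt_of_lt_one_left (norm_pos_iff.2 hg) ((div_lt_one hgj).2 hj)

theorem norm_tprod_le_norm_prod (hfm : Multipliable f) (hf : ∀ i, ‖f i‖ ≤ 1) (s : Finset ι) :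
    ‖∏' i, f i‖ ≤ ‖∏ i ∈ s, f i‖ := by
  classical
  refine le_of_tendsto hfm.hasProd.norm ?_
  filter_upwards [eventually_ge_atTop s] with t hst
  rw [norm_prod, ← Finset.prod_sdiff hst]
  exact mul_le_of_le_one_left (Finset.prod_nonneg fun _ _ => norm_nonneg _)
    (Finset.prod_le_one (fun _ _ => norm_nonneg _) fun i _ => hf i)

theorem norm_tprod_le_norm (hfm : Multipliable f) (hf : ∀ i, ‖f i‖ ≤ 1) (j : ι) :
    ‖∏' i, f i‖ ≤ ‖f j‖ := by
  simpa using norm_tprod_le_norm_prod hfm hf {j}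

theorem multipliable_of_summable_norm_sub_one [CompleteSpace 𝕜]
    (h : Summable fun i => ‖f i - 1‖) : Multipliable f := by
  simpa using multipliable_one_add_of_summable (f := fun i => f i - 1) h

end Products

/-! ### Cosine products of sequences that are summable modulo one -/

/-- The infinite product `∏ cos (2π aᵢ)`: the common shape of the Fourier transform of a Bernoulli
convolution and of its limits along `ξ θᴺ`. -/
noncomputable def cosProd {ι : Type*} (a : ι → ℝ) : ℝ := ∏' i, Real.cos (2 * π * a i)

/-- The distances from the terms of a real family to the nearest integers are summable; the distance
is encoded as the norm on `ℝ / ℤ`. -/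
def SummableModOne {ι : Type*} (a : ι → ℝ) : Prop := Summable fun i => ‖(a i : UnitAddCircle)‖

theorem norm_coe_unitAddCircle_le (x : ℝ) (n : ℤ) : ‖(x : UnitAddCircle)‖ ≤ |x - n| := by
  rw [UnitAddCircle.norm_eq]
  exact round_le x n

theorem two_pi_mul_eq_add_int_mul (x : ℝ) :
    2 * π * x = 2 * π * (x - round x) + round x * (2 * π) := by ring

theorem abs_two_pi_mul_sub_round (x : ℝ) :
    |2 * π * (x - round x)| = 2 * π * ‖(x : UnitAddCircle)‖ := by
  rw [UnitAddCircle.norm_eq, abs_mul, abs_of_pos Real.two_pi_pos]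

theorem abs_sin_two_pi_mul_le (x : ℝ) :
    |Real.sin (2 * π * x)| ≤ 2 * π * ‖(x : UnitAddCircle)‖ := by
  rw [two_pi_mul_eq_add_int_mul, Real.sin_add_int_mul_two_pi, ← abs_two_pi_mul_sub_round]
  exact Real.abs_sin_le_abs

theorem abs_cos_two_pi_mul_sub_one_le (x : ℝ) :
    |Real.cos (2 * π * x) - 1| ≤ 2 * π * ‖(x : UnitAddCircle)‖ := by
  rw [two_pi_mul_eq_add_int_mul, Real.cos_add_int_mul_two_pi, ← abs_two_pi_mul_sub_round]
  simpa using Real.abs_cos_sub_cos_le (2 * π * (x - round x)) 0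

namespace SummableModOne

variable {ι κ : Type*} {a b : ι → ℝ}

theorem of_summable_abs_sub_int {u : ι → ℤ} (h : Summable fun i => |a i - u i|) :
    SummableModOne a :=
  h.of_nonneg_of_le (fun _ => norm_nonneg _) fun i => norm_coe_unitAddCircle_le (a i) (u i)

theorem of_summable_abs (h : Summable fun i => |a i|) : SummableModOne a :=
  of_summable_abs_sub_int (u := 0) (by simpa using h)

theorem summable_abs_sub_round (h : SummableModOne a) : Summable fun i => |a i - round (a i)| :=
  h.congr fun _ => UnitAddCircle.norm_eq

protected theorem add (ha : SummableModOne a) (hb : SummableModOne b) :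
    SummableModOne fun i => a i + b i :=
  (Summable.add ha hb).of_nonneg_of_le (fun _ => norm_nonneg _) fun i => by
    rw [AddCircle.coe_add]
    exact norm_add_le _ _

protected theorem neg (ha : SummableModOne a) : SummableModOne fun i => -a i :=
  Summable.congr ha fun i => by rw [AddCircle.coe_neg, norm_neg]

protected theorem sub (ha : SummableModOne a) (hb : SummableModOne b) :
    SummableModOne fun i => a i - b i := by
  simpa only [sub_eq_add_neg] using ha.add hb.neg

theorem comp_injective (ha : SummableModOne a) {e : κ → ι} (he : Function.Injective e) :
    SummableModOne fun k => a (e k) :=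
  Summable.comp_injective (f := fun i => ‖(a i : UnitAddCircle)‖) ha he

theorem summable_abs_cos_sub_one (ha : SummableModOne a) :
    Summable fun i => |Real.cos (2 * π * a i) - 1| :=
  (ha.mul_left (2 * π)).of_nonneg_of_le (fun _ => abs_nonneg _) fun i =>
    abs_cos_two_pi_mul_sub_one_le (a i)

theorem summable_abs_sin (ha : SummableModOne a) : Summable fun i => |Real.sin (2 * π * a i)| :=
  (ha.mul_left (2 * π)).of_nonneg_of_le (fun _ => abs_nonneg _) fun i =>
    abs_sin_two_pi_mul_le (a i)

theorem summable_abs_sin_mul_sin (ha : SummableModOne a) (b : ι → ℝ) :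
    Summable fun i => |Real.sin (2 * π * a i) * Real.sin (2 * π * b i)| :=
  ha.summable_abs_sin.of_nonneg_of_le (fun _ => abs_nonneg _) fun i => by
    rw [abs_mul]
    exact mul_le_of_le_one_right (abs_nonneg _) (Real.abs_sin_le_one _)

theorem multipliable_cos (ha : SummableModOne a) :
    Multipliable fun i => Real.cos (2 * π * a i) :=
  multipliable_of_summable_norm_sub_one ha.summable_abs_cos_sub_one

theorem abs_cosProd_le_abs_cos (ha : SummableModOne a) (j : ι) :
    |cosProd a| ≤ |Real.cos (2 * π * a j)| :=
  norm_tprod_le_norm ha.multipliable_cos (fun _ => Real.abs_cos_le_one _) j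

theorem abs_cosProd_le_one (ha : SummableModOne a) : |cosProd a| ≤ 1 := by
  simpa [cosProd] using
    norm_tprod_le_norm_prod ha.multipliable_cos (fun _ => Real.abs_cos_le_one _) ∅

theorem abs_cosProd_lt_one (ha : SummableModOne a) {j : ι} (hj : Real.sin (2 * π * a j) ≠ 0) :
    |cosProd a| < 1 := by
  refine (ha.abs_cosProd_le_abs_cos j).trans_lt ?_
  rw [← sq_lt_one_iff_abs_lt_one]
  linarith [Real.sin_sq_add_cos_sq (2 * π * a j), sq_pos_of_ne_zero hj]

theorem cosProd_ne_zero (ha : SummableModOne a) (h : ∀ i, Real.cos (2 * π * a i) ≠ 0) :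
    cosProd a ≠ 0 := by
  simpa [cosProd] using tprod_one_add_ne_zero_of_summable
    (f := fun i => Real.cos (2 * π * a i) - 1) (by simpa using h) ha.summable_abs_cos_sub_one

theorem abs_cosProd_sub_le (ha : SummableModOne a) (hb : SummableModOne b)
    (hab : Summable fun i => |a i - b i|) :
    |cosProd a - cosProd b| ≤ 2 * π * ∑' i, |a i - b i| := by
  have hterm : ∀ i, |Real.cos (2 * π * a i) - Real.cos (2 * π * b i)| ≤ 2 * π * |a i - b i| :=
    fun i => (Real.abs_cos_sub_cos_le _ _).trans_eq (by
      rw [← mul_sub, abs_mul, abs_of_pos Real.two_pi_pos])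
  have hsum := (hab.mul_left (2 * π)).of_nonneg_of_le (fun _ => abs_nonneg _) hterm
  rw [← tsum_mul_left]
  exact (norm_tprod_sub_tprod_le ha.multipliable_cos hb.multipliable_cos
    (fun _ => Real.abs_cos_le_one _) (fun _ => Real.abs_cos_le_one _) hsum).trans
    (hsum.tsum_le_tsum hterm (hab.mul_left _))

theorem abs_cosProd_add_sub_mul_le (ha : SummableModOne a) (hb : SummableModOne b) :
    |cosProd (fun i => a i + b i) - cosProd a * cosProd b| ≤
      ∑' i, |Real.sin (2 * π * a i) * Real.sin (2 * π * b i)| := by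
  have hterm : ∀ i, Real.cos (2 * π * (a i + b i)) -
      Real.cos (2 * π * a i) * Real.cos (2 * π * b i) =
        -(Real.sin (2 * π * a i) * Real.sin (2 * π * b i)) := fun i => by
    rw [mul_add, Real.cos_add, sub_sub_cancel_left]
  have hmul := ha.multipliable_cos.tprod_mul hb.multipliable_cos
  have h := norm_tprod_sub_tprod_le (ha.add hb).multipliable_cos
    (ha.multipliable_cos.mul hb.multipliable_cos) (fun _ => Real.abs_cos_le_one _)
    (fun i => (norm_mul_le _ _).trans
      (mul_le_one₀ (Real.abs_cos_le_one _) (norm_nonneg _) (Real.abs_cos_le_one _)))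
    (by simpa only [hterm, norm_neg, Real.norm_eq_abs] using ha.summable_abs_sin_mul_sin b)
  simp only [hterm, norm_neg, Real.norm_eq_abs, hmul] at h
  exact h

/-- The identity behind this is
`cos (x + y) cos (x - y) = (cos x cos y)² - (sin x sin y)²`, applied factor by factor. -/
theorem abs_cosProd_add_mul_cosProd_sub_lt (ha : SummableModOne a) (hb : SummableModOne b)
    (hsum : ∑' i, |Real.sin (2 * π * a i) * Real.sin (2 * π * b i)| < |cosProd a * cosProd b|)
    {j : ι} (hj : Real.sin (2 * π * a j) * Real.sin (2 * π * b j) ≠ 0) :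
    |cosProd (fun i => a i + b i) * cosProd (fun i => a i - b i)| <
      (cosProd a * cosProd b) ^ 2 := by
  set S : ι → ℝ := fun i => Real.sin (2 * π * a i) * Real.sin (2 * π * b i)
  set K : ι → ℝ := fun i => Real.cos (2 * π * a i) * Real.cos (2 * π * b i) with hK
  have hfactor : ∀ i, Real.cos (2 * π * (a i + b i)) * Real.cos (2 * π * (a i - b i)) =
      K i ^ 2 - S i ^ 2 := fun i => by
    rw [mul_add, mul_sub, Real.cos_add, Real.cos_sub]
    ring
  have hSK : ∀ i, S i ^ 2 ≤ K i ^ 2 := fun i => sq_le_sq.2 <| calc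
    |S i| ≤ ∑' i, |S i| := (ha.summable_abs_sin_mul_sin b).le_tsum i fun _ _ => abs_nonneg _
    _ ≤ |cosProd a * cosProd b| := hsum.le
    _ ≤ |K i| := by
      rw [abs_mul, hK, abs_mul]
      exact mul_le_mul (ha.abs_cosProd_le_abs_cos i) (hb.abs_cosProd_le_abs_cos i)
        (abs_nonneg _) (abs_nonneg _)
  have hnorm : ∀ i, ‖K i ^ 2 - S i ^ 2‖ = ‖K i ^ 2‖ - S i ^ 2 := fun i => by
    rw [Real.norm_of_nonneg (sub_nonneg.2 (hSK i)), Real.norm_of_nonneg (sq_nonneg _)]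
  have hKm : Multipliable K := ha.multipliable_cos.mul hb.multipliable_cos
  have hKt : ∏' i, K i ^ 2 = (cosProd a * cosProd b) ^ 2 := by
    rw [hKm.tprod_pow, ha.multipliable_cos.tprod_mul hb.multipliable_cos, cosProd, cosProd]
  have hne : cosProd a * cosProd b ≠ 0 :=
    abs_pos.1 ((tsum_nonneg fun _ => abs_nonneg _).trans_lt hsum)
  have hpm := (ha.add hb).multipliable_cos.mul (ha.sub hb).multipliable_cos
  have hpt := (ha.add hb).multipliable_cos.tprod_mul (ha.sub hb).multipliable_cos
  simp only [hfactor] at hpm hpt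
  rw [cosProd, cosProd, ← hpt, ← abs_of_nonneg (sq_nonneg (cosProd a * cosProd b)), ← hKt]
  refine norm_tprod_lt_norm_tprod hpm (hKm.pow 2) (fun i => ?_) (j := j) ?_
    (hKt ▸ pow_ne_zero 2 hne)
  · rw [hnorm]
    exact sub_le_self _ (sq_nonneg _)
  · rw [hnorm]
    exact sub_lt_self _ (sq_pos_of_ne_zero hj)

end SummableModOne

theorem cosProd_neg {ι : Type*} (a : ι → ℝ) : cosProd (fun i => -a i) = cosProd a := by
  simp only [cosProd, mul_neg, Real.cos_neg]

theorem cosProd_comp_equiv {ι κ : Type*} (e : κ ≃ ι) (a : ι → ℝ) :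
    cosProd (fun k => a (e k)) = cosProd a :=
  e.tprod_eq fun i => Real.cos (2 * π * a i)

section Shifts

variable {a b : ℤ → ℝ}

theorem tendsto_tsum_abs_sin_mul_sin_shift (ha : SummableModOne a) (hb : SummableModOne b) :
    Tendsto (fun N : ℕ => ∑' j, |Real.sin (2 * π * a j) * Real.sin (2 * π * b (N + j))|)
      atTop (𝓝 0) := by
  rw [← tsum_zero (α := ℝ) (β := ℤ)]
  refine tendsto_tsum_of_dominated_convergence ha.summable_abs_sin (fun j => ?_)
    (Eventually.of_forall fun N j => ?_)
  · have hshift : Tendsto (fun N : ℕ => (N : ℤ) + j) atTop cofinite := by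
      rw [← Nat.cofinite_eq_atTop]
      exact Function.Injective.tendsto_cofinite fun m n h => by simpa using h
    refine squeeze_zero (fun _ => abs_nonneg _) (fun N => ?_)
      (hb.summable_abs_sin.tendsto_cofinite_zero.comp hshift)
    rw [abs_mul]
    exact mul_le_of_le_one_left (abs_nonneg _) (Real.abs_sin_le_one _)
  · rw [norm_abs_eq_norm, norm_mul]
    exact mul_le_of_le_one_right (abs_nonneg _) (Real.abs_sin_le_one _)

theorem tendsto_cosProd_add_shift (ha : SummableModOne a) (hb : SummableModOne b) :
    Tendsto (fun N : ℕ => cosProd fun j => a j + b (N + j)) atTop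
      (𝓝 (cosProd a * cosProd b)) := by
  rw [tendsto_iff_dist_tendsto_zero]
  refine squeeze_zero (fun _ => dist_nonneg) (fun N => ?_)
    (tendsto_tsum_abs_sin_mul_sin_shift ha hb)
  rw [Real.dist_eq, ← cosProd_comp_equiv (Equiv.addLeft (N : ℤ)) b]
  exact ha.abs_cosProd_add_sub_mul_le (hb.comp_injective (Equiv.addLeft (N : ℤ)).injective)

theorem tendsto_cosProd_nat_sub (ha : SummableModOne a) :
    Tendsto (fun N : ℕ => cosProd fun k : ℕ => a (N - k)) atTop (𝓝 (cosProd a)) := by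
  let f : ℕ → ℤ → ℝ := fun N => (Iic (N : ℤ)).indicator fun j => Real.cos (2 * π * a j) - 1
  have hf : ∀ N : ℕ, ∏' j, (1 + f N j) = cosProd fun k : ℕ => a (N - k) := fun N => by
    have hinj : Function.Injective fun k : ℕ => (N : ℤ) - k :=
      sub_right_injective.comp Nat.cast_injective
    rw [← hinj.tprod_eq (f := fun j => 1 + f N j)]
    · simp [f, cosProd]
    · intro j hj
      have hjN : j ≤ N := by
        by_contra h
        exact hj (by simp [f, h])
      exact ⟨(N - j).toNat, by simp [hjN]⟩
  have hlim := tendsto_tprod_one_add_of_dominated_convergence (f := f) (𝓕 := atTop)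
    (g := fun j => Real.cos (2 * π * a j) - 1) ha.summable_abs_cos_sub_one (fun j => ?_)
    (Eventually.of_forall fun N j => norm_indicator_le_norm_self _ _)
  · simpa only [hf, add_sub_cancel, cosProd] using hlim
  · refine tendsto_const_nhds.congr' ?_
    filter_upwards [eventually_ge_atTop j.toNat] with N hN
    simp [f, Int.toNat_le.1 hN]

end Shifts

/-! ### The Fourier transform of the Bernoulli convolution -/

theorem fourierTransform_eq_charFun (μ : Measure ℝ) (t : ℝ) :
    fourierTransform μ t = charFun μ (-(2 * π * t)) := by
  rw [fourierTransform, charFun_apply_real]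
  congr 1 with x
  push_cast
  ring_nf

section InfiniteConvolution

variable {ν : ℕ → Measure ℝ} [∀ k, IsProbabilityMeasure (ν k)]

theorem charFun_map_sum_range_infinitePi (n : ℕ) :
    charFun ((Measure.infinitePi ν).map fun x => ∑ k ∈ Finset.range n, x k) =
      ∏ k ∈ Finset.range n, charFun (ν k) := by
  have hind := (ProbabilityTheory.iIndepFun_infinitePi (P := ν) (X := fun _ y => y)
    fun _ => measurable_id).restrict (Finset.range n)
  rw [hind.charFun_map_fun_finsetSum_eq_prod fun k _ => (measurable_pi_apply k).aemeasurable]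
  exact Finset.prod_congr rfl fun k _ => by rw [(measurePreserving_eval_infinitePi ν k).map_eq]

theorem tendsto_prod_charFun_infiniteConvolution
    (hν : ∀ᵐ x ∂Measure.infinitePi ν, Summable x) (t : ℝ) :
    Tendsto (fun n => ∏ k ∈ Finset.range n, charFun (ν k) t) atTop
      (𝓝 (charFun (infiniteConvolution ν) t)) := by
  have hlim : ∀ᵐ x ∂Measure.infinitePi ν,
      Tendsto (fun n => ∑ k ∈ Finset.range n, x k) atTop (𝓝 (∑' k, x k)) :=
    hν.mono fun x hx => hx.hasSum.tendsto_sum_nat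
  have hmeas : ∀ n, AEMeasurable (fun x : ℕ → ℝ => ∑ k ∈ Finset.range n, x k)
      (Measure.infinitePi ν) := fun n => by fun_prop
  have hdist := (tendstoInDistribution_of_ae_tendsto hmeas
    (aemeasurable_of_tendsto_metrizable_ae atTop hmeas hlim) hlim).tendsto
  simpa [charFun_map_sum_range_infinitePi, infiniteConvolution] using
    ProbabilityMeasure.tendsto_iff_tendsto_charFun.1 hdist t

theorem ae_summable_infinitePi_of_ae_abs_le {c : ℕ → ℝ} (hc : Summable c)
    (hν : ∀ k, ∀ᵐ y ∂ν k, |y| ≤ c k) : ∀ᵐ x ∂Measure.infinitePi ν, Summable x := by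
  have hbound : ∀ᵐ x ∂Measure.infinitePi ν, ∀ k, |x k| ≤ c k := ae_all_iff.2 fun k =>
    (measurePreserving_eval_infinitePi ν k).quasiMeasurePreserving.ae (hν k)
  exact hbound.mono fun x hx => hc.of_norm_bounded hx

end InfiniteConvolution

theorem ae_abs_le_twoPoint (c : ℝ) : ∀ᵐ y ∂twoPoint c, |y| ≤ |c| := by
  refine ae_add_measure_iff.2 ⟨Measure.ae_smul_measure ?_ _, Measure.ae_smul_measure ?_ _⟩ <;>
    simp [ae_dirac_eq]

theorem charFun_twoPoint (c t : ℝ) : charFun (twoPoint c) t = Real.cos (t * c) := by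
  have hint : ∀ x : ℝ, Integrable (fun y : ℝ => Complex.exp (t * y * Complex.I))
      ((2⁻¹ : ℝ≥0∞) • Measure.dirac x) := fun x =>
    (integrable_dirac (by simp)).smul_measure (by simp)
  rw [charFun_apply_real, twoPoint, integral_add_measure (hint _) (hint _), integral_smul_measure,
    integral_smul_measure, integral_dirac, integral_dirac, Complex.ofReal_cos, Complex.cos]
  simp only [ENNReal.toReal_inv, ENNReal.toReal_ofNat, Complex.real_smul]
  push_cast
  ring_nf

/-- The Fourier transform of the Bernoulli convolution in closed form, `∏ cos (2π t θ⁻ᵏ)`. -/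
noncomputable def bernoulliFourier (θ t : ℝ) : ℝ := cosProd fun k : ℕ => t * (θ ^ k)⁻¹

section BernoulliFourier

variable {θ : ℝ}

theorem summable_inv_pow (hθ : 1 < θ) : Summable fun k : ℕ => (θ ^ k)⁻¹ := by
  simp_rw [← inv_pow]
  exact summable_geometric_of_lt_one (by positivity) (inv_lt_one_of_one_lt₀ hθ)

theorem summableModOne_mul_inv_pow (hθ : 1 < θ) (t : ℝ) :
    SummableModOne fun k : ℕ => t * (θ ^ k)⁻¹ :=
  .of_summable_abs ((summable_inv_pow hθ).mul_left t).abs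

theorem fourierTransform_bernoulliConvolution (hθ : 1 < θ) (t : ℝ) :
    fourierTransform (bernoulliConvolution θ) t = bernoulliFourier θ t := by
  have hsum : ∀ᵐ x ∂Measure.infinitePi fun k : ℕ => twoPoint ((θ ^ k)⁻¹), Summable x :=
    ae_summable_infinitePi_of_ae_abs_le (summable_inv_pow hθ).abs fun k => ae_abs_le_twoPoint _
  rw [fourierTransform_eq_charFun]
  refine tendsto_nhds_unique (tendsto_prod_charFun_infiniteConvolution hsum _) ?_
  have hprod := (summableModOne_mul_inv_pow hθ t).multipliable_cos.hasProd.tendsto_prod_nat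
  refine ((Complex.continuous_ofReal.tendsto _).comp hprod).congr fun n => ?_
  simp only [Function.comp_apply, Complex.ofReal_prod, charFun_twoPoint, neg_mul, Real.cos_neg,
    mul_assoc]

theorem bernoulliFourier_neg (θ t : ℝ) : bernoulliFourier θ (-t) = bernoulliFourier θ t := by
  simp only [bernoulliFourier, neg_mul, cosProd_neg]

theorem abs_bernoulliFourier_le_one (hθ : 1 < θ) (t : ℝ) : |bernoulliFourier θ t| ≤ 1 :=
  (summableModOne_mul_inv_pow hθ t).abs_cosProd_le_one

theorem abs_bernoulliFourier_sub_le (hθ : 1 < θ) (s t : ℝ) :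
    |bernoulliFourier θ s - bernoulliFourier θ t| ≤ 2 * π * (∑' k : ℕ, (θ ^ k)⁻¹) * |s - t| := by
  have hterm : ∀ k : ℕ, |s * (θ ^ k)⁻¹ - t * (θ ^ k)⁻¹| = |s - t| * (θ ^ k)⁻¹ := fun k => by
    rw [← sub_mul, abs_mul, abs_of_pos (by positivity : 0 < (θ ^ k)⁻¹)]
  refine ((summableModOne_mul_inv_pow hθ s).abs_cosProd_sub_le (summableModOne_mul_inv_pow hθ t)
    ?_).trans_eq ?_
  · simpa only [hterm] using (summable_inv_pow hθ).mul_left |s - t|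
  · simp only [hterm, tsum_mul_left]
    ring

theorem exists_lipschitzWith_bernoulliFourier (hθ : 1 < θ) :
    ∃ K, LipschitzWith K (bernoulliFourier θ) :=
  ⟨⟨2 * π * ∑' k : ℕ, (θ ^ k)⁻¹, mul_nonneg (by positivity) (tsum_nonneg fun _ => by positivity)⟩,
    LipschitzWith.of_dist_le_mul (abs_bernoulliFourier_sub_le hθ)⟩

end BernoulliFourier

/-! ### Conjugates of Pisot numbers -/

open IntermediateField in
theorem exists_natCast_mul_eq_aeval {K : Type*} [Field K] [Algebra ℚ K] {x y : K}
    (hy : IsAlgebraic ℚ y) (hx : x ∈ ℚ⟮y⟯) :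
    ∃ D : ℕ, 0 < D ∧ ∃ p : Polynomial ℤ, (D : K) * x = Polynomial.aeval y p := by
  obtain ⟨q, rfl⟩ : ∃ q : Polynomial ℚ, Polynomial.aeval y q = x := by
    rwa [← mem_toSubalgebra, adjoin_simple_toSubalgebra_of_isAlgebraic hy,
      Algebra.adjoin_singleton_eq_range_aeval] at hx
  obtain ⟨b, hb, hbq⟩ := IsLocalization.integerNormalization_spec (nonZeroDivisors ℤ) q
  have hb0 : b ≠ 0 := nonZeroDivisors.ne_zero hb
  set p := IsLocalization.integerNormalization (nonZeroDivisors ℤ) q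
  have hbp : (b : K) * Polynomial.aeval y q = Polynomial.aeval y p := by
    rw [← Polynomial.aeval_map_algebraMap ℚ y p, hbq, map_zsmul, zsmul_eq_mul]
  refine ⟨b.natAbs, Int.natAbs_pos.2 hb0, b.sign • p, ?_⟩
  rw [map_zsmul, ← hbp, zsmul_eq_mul, ← mul_assoc, ← Int.cast_mul, ← Int.cast_natCast,
    Int.sign_mul_self_eq_natAbs]

open IntermediateField in
theorem inv_mem_adjoin_inv {F K : Type*} [Field F] [Field K] [Algebra F K] {x y : K}
    (hx : x ∈ F⟮y⟯) : x⁻¹ ∈ F⟮y⁻¹⟯ := by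
  have h : F⟮y⟯ ≤ F⟮y⁻¹⟯ := by
    rw [adjoin_simple_le_iff]
    simpa using inv_mem (mem_adjoin_simple_self F y⁻¹)
  exact inv_mem (h hx)

namespace IsPisot

variable {θ : ℝ}

theorem isIntegral_rat (hθ : IsPisot θ) : IsIntegral ℚ θ :=
  hθ.2.1.tower_top

theorem exists_map_minpoly_eq (hθ : IsPisot θ) :
    ∃ s : Multiset ℂ, (minpoly ℚ θ).map (algebraMap ℚ ℂ) =
      (Polynomial.X - Polynomial.C (θ : ℂ)) * (s.map fun α => Polynomial.X - Polynomial.C α).prod ∧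
      ∀ α ∈ s, ‖α‖ < 1 := by
  classical
  set P := (minpoly ℚ θ).map (algebraMap ℚ ℂ) with hP
  have hmon : P.Monic := (minpoly.monic hθ.isIntegral_rat).map _
  have hroot : ∀ α : ℂ, α ∈ P.roots ↔ Polynomial.aeval α (minpoly ℚ θ) = 0 := fun α => by
    rw [Polynomial.mem_roots hmon.ne_zero, Polynomial.IsRoot, hP, Polynomial.eval_map_algebraMap]
  have hnodup : P.roots.Nodup := Polynomial.nodup_roots
    (Polynomial.Separable.map (minpoly.irreducible hθ.isIntegral_rat).separable)
  have hmem : (θ : ℂ) ∈ P.roots := (hroot θ).2 <|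
    (Polynomial.aeval_algebraMap_apply ℂ θ (minpoly ℚ θ)).trans (by simp)
  refine ⟨P.roots.erase θ, ?_, fun α hα => ?_⟩
  · rw [← Multiset.prod_cons, ← Multiset.map_cons (fun α : ℂ => Polynomial.X - Polynomial.C α),
      Multiset.cons_erase hmem]
    exact (IsAlgClosed.splits P).eq_prod_roots_of_monic hmon
  · rw [hnodup.mem_erase_iff] at hα
    exact hθ.2.2 α ((hroot α).1 hα.2) hα.1

theorem exists_conjugate_norm_lt_one (hθ : IsPisot θ) (hirr : Irrational θ) :
    ∃ z : ℂ, Polynomial.aeval z (minpoly ℚ θ) = 0 ∧ ‖z‖ < 1 := by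
  obtain ⟨s, hs, hs1⟩ := hθ.exists_map_minpoly_eq
  have hs0 : s ≠ 0 := by
    rintro rfl
    have hdeg := congrArg Polynomial.natDegree hs
    simp only [Polynomial.natDegree_map, Multiset.map_zero, Multiset.prod_zero, mul_one,
      Polynomial.natDegree_X_sub_C, minpoly.natDegree_eq_one_iff] at hdeg
    exact hirr hdeg
  obtain ⟨z, hz⟩ := Multiset.exists_mem_of_ne_zero hs0
  refine ⟨z, ?_, hs1 z hz⟩
  rw [← Polynomial.eval_map_algebraMap, hs, Polynomial.eval_mul, Polynomial.eval_multiset_prod,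
    Multiset.map_map, Multiset.prod_eq_zero (Multiset.mem_map.2 ⟨z, hz, by simp⟩), mul_zero]

theorem irrational_pow (hθ : IsPisot θ) (hirr : Irrational θ) {n : ℕ} (hn : n ≠ 0) :
    Irrational (θ ^ n) := by
  rintro ⟨q, hq⟩
  obtain ⟨z, hz, hz1⟩ := hθ.exists_conjugate_norm_lt_one hirr
  have hdvd : minpoly ℚ θ ∣ Polynomial.X ^ n - Polynomial.C q := minpoly.dvd _ _ (by simp [hq])
  have hzq : z ^ n = ((q : ℝ) : ℂ) := by
    simpa [sub_eq_zero] using Polynomial.aeval_eq_zero_of_dvd_aeval_eq_zero hdvd hz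
  have hnorm : ‖z‖ ^ n = |θ| ^ n := by
    rw [← norm_pow, hzq, hq, Complex.norm_real, Real.norm_eq_abs, abs_pow]
  have hlt : ‖z‖ ^ n < 1 := pow_lt_one₀ (norm_nonneg _) hz1 hn
  have hgt : 1 < |θ| ^ n := one_lt_pow₀ (hθ.1.trans_le (le_abs_self θ)) hn
  linarith

open IntermediateField in
theorem norm_algHom_gen_lt_one (hθ : IsPisot θ) {σ : ℚ⟮θ⟯ →ₐ[ℚ] ℂ}
    (hσ : σ (AdjoinSimple.gen ℚ θ) ≠ θ) : ‖σ (AdjoinSimple.gen ℚ θ)‖ < 1 := by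
  refine hθ.2.2 _ ?_ hσ
  rw [← minpoly_gen, Polynomial.aeval_algHom_apply]
  exact (congrArg σ (minpoly.aeval ℚ _)).trans (map_zero σ)

open IntermediateField in
theorem exists_abs_pow_sub_intCast_le (hθ : IsPisot θ) :
    ∃ s : Finset (ℚ⟮θ⟯ →ₐ[ℚ] ℂ), (∀ σ ∈ s, ‖σ (AdjoinSimple.gen ℚ θ)‖ < 1) ∧
      ∀ N : ℕ, ∃ u : ℤ, |θ ^ N - u| ≤ ∑ σ ∈ s, ‖σ (AdjoinSimple.gen ℚ θ)‖ ^ N := by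
  classical
  have hint := hθ.isIntegral_rat
  have : FiniteDimensional ℚ ℚ⟮θ⟯ := adjoin.finiteDimensional hint
  set x : ℚ⟮θ⟯ := AdjoinSimple.gen ℚ θ
  have hxint : IsIntegral ℤ x :=
    (isIntegral_algebraMap_iff (algebraMap ℚ⟮θ⟯ ℝ).injective).1 hθ.2.1
  let σ₀ : ℚ⟮θ⟯ →ₐ[ℚ] ℂ := (Complex.ofRealAm.restrictScalars ℚ).comp ℚ⟮θ⟯.val
  have hσ₀ : σ₀ x = θ := rfl
  refine ⟨Finset.univ.erase σ₀, fun σ hσ => hθ.norm_algHom_gen_lt_one fun h =>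
    Finset.ne_of_mem_erase hσ ((adjoin.powerBasis hint).algHom_ext ?_), fun N => ?_⟩
  · rw [adjoin.powerBasis_gen]
    exact h.trans hσ₀.symm
  obtain ⟨u, hu⟩ : ∃ u : ℤ, (u : ℚ) = Algebra.trace ℚ ℚ⟮θ⟯ (x ^ N) :=
    IsIntegrallyClosed.isIntegral_iff.1 (Algebra.isIntegral_trace (hxint.pow N))
  refine ⟨u, ?_⟩
  have htrace : (u : ℂ) = θ ^ N + ∑ σ ∈ Finset.univ.erase σ₀, σ x ^ N := by
    have h := trace_eq_sum_embeddings ℂ (K := ℚ) (L := ℚ⟮θ⟯) (x := x ^ N)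
    simpa only [← hu, map_intCast, map_pow, hσ₀, ← Finset.add_sum_erase _ _ (Finset.mem_univ σ₀)]
      using h
  have hsub : ((θ ^ N - u : ℝ) : ℂ) = -∑ σ ∈ Finset.univ.erase σ₀, σ x ^ N := by
    push_cast
    rw [htrace]
    ring
  rw [← Real.norm_eq_abs, ← Complex.norm_real, hsub, norm_neg]
  exact (norm_sum_le _ _).trans_eq (by simp only [norm_pow])

end IsPisot

/-- The group of real numbers `ξ` for which the distances from `ξ θᴺ`, `N ≥ 0`, to the integers are
summable. -/
def pisotModule (θ : ℝ) : AddSubgroup ℝ where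
  carrier := {ξ | SummableModOne fun N : ℕ => ξ * θ ^ N}
  zero_mem' := .of_summable_abs (by simp)
  add_mem' := fun hξ hη => by simpa only [mem_ofPred_eq, add_mul] using hξ.add hη
  neg_mem' := fun hξ => by simpa only [mem_ofPred_eq, neg_mul] using hξ.neg

theorem mul_pow_mem_pisotModule {θ ξ : ℝ} (h : ξ ∈ pisotModule θ) (n : ℕ) :
    ξ * θ ^ n ∈ pisotModule θ := by
  change SummableModOne fun N : ℕ => ξ * θ ^ n * θ ^ N
  simpa only [mul_assoc, ← pow_add] using h.comp_injective (add_right_injective n)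

theorem IsPisot.one_mem_pisotModule {θ : ℝ} (hθ : IsPisot θ) : (1 : ℝ) ∈ pisotModule θ := by
  obtain ⟨s, hs, hN⟩ := hθ.exists_abs_pow_sub_intCast_le
  choose u hu using hN
  have hsum : Summable fun N : ℕ => |θ ^ N - u N| :=
    (summable_sum fun σ hσ => summable_geometric_of_lt_one (norm_nonneg _)
      (hs σ hσ)).of_nonneg_of_le (fun _ => abs_nonneg _) hu
  exact .of_summable_abs_sub_int (u := u) (by simpa only [one_mul] using hsum)

theorem IsPisot.aeval_mem_pisotModule {θ : ℝ} (hθ : IsPisot θ) (p : Polynomial ℤ) :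
    Polynomial.aeval θ p ∈ pisotModule θ := by
  rw [Polynomial.aeval_eq_sum_range]
  refine sum_mem fun i _ => zsmul_mem ?_ _
  simpa using mul_pow_mem_pisotModule hθ.one_mem_pisotModule i

/-! ### Two-sided cosine products along orbits of multiplication by a Pisot number -/

/-- The two-sided product `∏ cos (2π ξ θʲ)` over all integers `j`: the limit of the Fourier
transform along `ξ θᴺ`. -/
noncomputable def orbitCosProd (θ ξ : ℝ) : ℝ := cosProd fun j : ℤ => ξ * θ ^ j

section Orbit

variable {θ ξ η : ℝ}

theorem mul_pow_mul_zpow (hθ : θ ≠ 0) (ξ : ℝ) (N : ℕ) (j : ℤ) :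
    ξ * θ ^ N * θ ^ j = ξ * θ ^ ((N : ℤ) + j) := by
  rw [zpow_add₀ hθ, zpow_natCast, mul_assoc]

theorem summableModOne_mul_zpow (hθ : 1 < θ) (hξ : ξ ∈ pisotModule θ) :
    SummableModOne fun j : ℤ => ξ * θ ^ j := by
  refine Summable.of_nat_of_neg_add_one ?_ ?_
  · exact Summable.congr hξ fun n => by simp only [zpow_natCast]
  · refine ((summableModOne_mul_inv_pow hθ ξ).comp_injective (add_left_injective 1)).congr
      fun n => ?_
    simp only [zpow_neg, ← Nat.cast_add_one, zpow_natCast]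

theorem orbitCosProd_mul_pow (hθ : θ ≠ 0) (ξ : ℝ) (N : ℕ) :
    orbitCosProd θ (ξ * θ ^ N) = orbitCosProd θ ξ := by
  simp only [orbitCosProd, mul_pow_mul_zpow hθ]
  exact cosProd_comp_equiv (Equiv.addLeft (N : ℤ)) fun j => ξ * θ ^ j

theorem tendsto_orbitCosProd_add_mul_pow (hθ : 1 < θ) (hξ : ξ ∈ pisotModule θ)
    (hη : η ∈ pisotModule θ) :
    Tendsto (fun N : ℕ => orbitCosProd θ (ξ + η * θ ^ N)) atTop
      (𝓝 (orbitCosProd θ ξ * orbitCosProd θ η)) := by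
  simpa only [orbitCosProd, add_mul, mul_pow_mul_zpow (zero_lt_one.trans hθ).ne'] using
    tendsto_cosProd_add_shift (summableModOne_mul_zpow hθ hξ) (summableModOne_mul_zpow hθ hη)

theorem tendsto_bernoulliFourier_mul_pow (hθ : 1 < θ) (hξ : ξ ∈ pisotModule θ) :
    Tendsto (fun N : ℕ => bernoulliFourier θ (ξ * θ ^ N)) atTop (𝓝 (orbitCosProd θ ξ)) := by
  refine (tendsto_cosProd_nat_sub (summableModOne_mul_zpow hθ hξ)).congr fun N => ?_
  simp only [bernoulliFourier, zpow_sub₀ (zero_lt_one.trans hθ).ne', zpow_natCast, div_eq_mul_inv,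
    mul_assoc]

theorem eventually_sin_two_pi_mul_zpow_neg_pos (hθ : 1 < θ) (hξ : 0 < ξ) :
    ∀ᶠ k : ℕ in atTop, 0 < Real.sin (2 * π * (ξ * θ ^ (-(k : ℤ)))) := by
  have hlim : Tendsto (fun k : ℕ => ξ * θ⁻¹ ^ k) atTop (𝓝 0) := by
    simpa using (tendsto_pow_atTop_nhds_zero_of_lt_one (by positivity)
      (inv_lt_one_of_one_lt₀ hθ)).const_mul ξ
  filter_upwards [hlim.eventually_lt_const one_half_pos] with k hk
  rw [zpow_neg, zpow_natCast, ← inv_pow]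
  exact Real.sin_pos_of_pos_of_lt_pi (by positivity) (by nlinarith [Real.pi_pos])

theorem abs_orbitCosProd_lt_one (hθ : 1 < θ) (hξ : ξ ∈ pisotModule θ) (hpos : 0 < ξ) :
    |orbitCosProd θ ξ| < 1 := by
  obtain ⟨k, hk⟩ := (eventually_sin_two_pi_mul_zpow_neg_pos hθ hpos).exists
  exact (summableModOne_mul_zpow hθ hξ).abs_cosProd_lt_one hk.ne'

theorem eventually_orbitCosProd_ne_sq (hθ : 1 < θ) (hξ : ξ ∈ pisotModule θ) (hpos : 0 < ξ)
    (hne : orbitCosProd θ ξ ≠ 0) :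
    ∀ᶠ N : ℕ in atTop, orbitCosProd θ (ξ + ξ * θ ^ N) ≠ orbitCosProd θ ξ ^ 2 ∨
      orbitCosProd θ (ξ + -ξ * θ ^ N) ≠ orbitCosProd θ ξ ^ 2 := by
  have hθ0 : θ ≠ 0 := (zero_lt_one.trans hθ).ne'
  have hsum := summableModOne_mul_zpow hθ hξ
  filter_upwards [(tendsto_tsum_abs_sin_mul_sin_shift hsum hsum).eventually_lt_const
    (show 0 < |orbitCosProd θ ξ * orbitCosProd θ ξ| by positivity)] with N hN
  obtain ⟨k, hk, hkN⟩ := ((eventually_sin_two_pi_mul_zpow_neg_pos hθ hpos).and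
    (eventually_sin_two_pi_mul_zpow_neg_pos hθ (show 0 < ξ * θ ^ N by positivity))).exists
  have hlt := hsum.abs_cosProd_add_mul_cosProd_sub_lt
    (summableModOne_mul_zpow hθ (mul_pow_mem_pisotModule hξ N)) (j := -(k : ℤ)) ?_
    (mul_pos hk hkN).ne'
  · simp only [← add_mul, ← sub_mul] at hlt
    change |orbitCosProd θ (ξ + ξ * θ ^ N) * orbitCosProd θ (ξ - ξ * θ ^ N)| <
      (orbitCosProd θ ξ * orbitCosProd θ (ξ * θ ^ N)) ^ 2 at hlt
    rw [orbitCosProd_mul_pow hθ0] at hlt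
    by_contra! h
    rw [neg_mul, ← sub_eq_add_neg] at h
    rw [h.1, h.2, abs_of_nonneg (by positivity)] at hlt
    exact hlt.ne (by ring)
  · change _ < |orbitCosProd θ ξ * orbitCosProd θ (ξ * θ ^ N)|
    rw [orbitCosProd_mul_pow hθ0]
    simpa only [mul_pow_mul_zpow hθ0] using hN

end Orbit

/-! ### Infinitely many accumulation points -/

theorem lt_of_two_mul_mul_pow_eq {m o o' n n' : ℕ} (hm : 0 < m) (ho' : Odd o')
    (h : 2 * (o * m ^ n) = o' * m ^ n') : n < n' := by
  by_contra! hn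
  obtain ⟨k, rfl⟩ := Nat.exists_eq_add_of_le hn
  have heven : 2 * (o * m ^ k) = o' := by
    refine Nat.eq_of_mul_eq_mul_right (show 0 < m ^ n' by positivity) ?_
    rw [← h, pow_add]
    ring
  exact Nat.not_odd_iff_even.2 ⟨o * m ^ k, by omega⟩ ho'

-- If `D * 2 ^ e = o e * m ^ n e` for all `e`, then `n` is strictly increasing, so that
-- `3 ^ e ≤ D * 2 ^ e`.
theorem exists_forall_odd_mul_two_pow_ne (D : ℕ) {m : ℕ} (hm : 3 ≤ m) :
    ∃ e : ℕ, ∀ o n : ℕ, Odd o → D * 2 ^ e ≠ o * m ^ n := by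
  by_contra! h
  choose o n ho hon using h
  have hm0 : 0 < m := by omega
  have hmono : StrictMono n := strictMono_nat_of_lt_succ fun e =>
    lt_of_two_mul_mul_pow_eq hm0 (ho (e + 1)) <| by
      rw [← hon, ← hon, pow_succ]
      ring
  have hle (e : ℕ) : ((3 : ℝ) / 2) ^ e ≤ D := by
    rw [div_pow, div_le_iff₀ (by positivity)]
    have hpow : 3 ^ e ≤ D * 2 ^ e := by
      calc 3 ^ e ≤ m ^ e := Nat.pow_le_pow_left hm e
        _ ≤ m ^ n e := Nat.pow_le_pow_right hm0 hmono.le_apply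
        _ ≤ o e * m ^ n e := Nat.le_mul_of_pos_left _ (ho e).pos
        _ = D * 2 ^ e := (hon e).symm
    exact_mod_cast hpow
  obtain ⟨e, he⟩ := pow_unbounded_of_one_lt (D : ℝ) (show (1 : ℝ) < 3 / 2 by norm_num)
  exact he.not_ge (hle e)

theorem exists_two_pow_mul_zpow_natCast_ne_odd {D m : ℕ} (hD : 0 < D) (hm : 3 ≤ m) :
    ∃ e : ℕ, ∀ j k : ℤ, 4 * ((D * 2 ^ e : ℕ) : ℝ) * (m : ℝ) ^ j ≠ 2 * k + 1 := by
  obtain ⟨e, he⟩ := exists_forall_odd_mul_two_pow_ne (4 * D) hm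
  have hm0 : (m : ℝ) ≠ 0 := by positivity
  refine ⟨e, fun j k hjk => ?_⟩
  obtain ⟨n, rfl | rfl⟩ := j.eq_nat_or_neg
  · rw [zpow_natCast] at hjk
    have hint : 2 * (2 * ((D * 2 ^ e * m ^ n : ℕ) : ℤ)) = 2 * k + 1 := by
      have : 4 * ((D * 2 ^ e : ℕ) : ℤ) * (m : ℤ) ^ n = 2 * k + 1 := by exact_mod_cast hjk
      rw [← this]
      push_cast
      ring
    omega
  · have hk : 0 ≤ 2 * k + 1 := by
      have : (0 : ℝ) ≤ 2 * k + 1 := hjk ▸ by positivity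
      exact_mod_cast this
    obtain ⟨o, ho⟩ := Int.eq_ofNat_of_zero_le hk
    refine he o n ((Int.odd_coe_nat o).1 (ho ▸ odd_two_mul_add_one k)) ?_
    have hoR : 2 * (k : ℝ) + 1 = o := by exact_mod_cast ho
    rw [zpow_neg, zpow_natCast, hoR, ← div_eq_mul_inv, div_eq_iff (pow_ne_zero n hm0)] at hjk
    rw [mul_assoc]
    exact_mod_cast hjk

namespace IsPisot

variable {θ : ℝ}

theorem exists_eq_natCast_of_not_irrational (hθ : IsPisot θ) (hrat : ¬ Irrational θ) :
    ∃ m : ℕ, θ = m := by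
  obtain ⟨q, rfl⟩ := not_not.1 hrat
  have hq : IsIntegral ℤ q :=
    (isIntegral_algebraMap_iff (algebraMap ℚ ℝ).injective).1 (by simpa using hθ.2.1)
  obtain ⟨z, rfl⟩ := IsIntegrallyClosed.isIntegral_iff.1 hq
  have hz : 1 < z := by exact_mod_cast (by simpa using hθ.1 : (1 : ℝ) < z)
  obtain ⟨m, rfl⟩ := Int.eq_ofNat_of_zero_le (zero_le_one.trans hz.le)
  exact ⟨m, by simp⟩

theorem mul_zpow_ne_odd_of_irrational (hθ : IsPisot θ) (hirr : Irrational θ) {D : ℕ}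
    (hD : 0 < D) (j k : ℤ) : 4 * (D : ℝ) * θ ^ j ≠ 2 * k + 1 := by
  intro h
  have hrat : θ ^ j = (((2 * k + 1) / (4 * D) : ℚ) : ℝ) := by
    push_cast
    rw [← h]
    field_simp
  rcases eq_or_ne j 0 with rfl | hj
  · rw [zpow_zero, mul_one] at h
    have hint : (4 * D : ℤ) = 2 * k + 1 := by exact_mod_cast h
    omega
  · obtain ⟨n, rfl | rfl⟩ := j.eq_nat_or_neg
    · rw [zpow_natCast] at hrat
      exact (hθ.irrational_pow hirr (by simpa using hj)).ne_rat _ hrat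
    · rw [zpow_neg, zpow_natCast] at hrat
      exact (irrational_inv_iff.2 (hθ.irrational_pow hirr (by simpa using hj))).ne_rat _ hrat

theorem exists_mul_zpow_ne_odd (hθ : IsPisot θ) (hθ2 : θ ≠ 2) {D : ℕ} (hD : 0 < D) :
    ∃ e : ℕ, ∀ j k : ℤ, 4 * ((D * 2 ^ e : ℕ) : ℝ) * θ ^ j ≠ 2 * k + 1 := by
  by_cases hirr : Irrational θ
  · exact ⟨0, hθ.mul_zpow_ne_odd_of_irrational hirr (by simpa)⟩
  · obtain ⟨m, rfl⟩ := hθ.exists_eq_natCast_of_not_irrational hirr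
    have hm1 : 1 < m := by exact_mod_cast hθ.1
    have hm2 : m ≠ 2 := by exact_mod_cast hθ2
    exact exists_two_pow_mul_zpow_natCast_ne_odd hD (by omega)

theorem natCast_mem_pisotModule (hθ : IsPisot θ) (n : ℕ) : (n : ℝ) ∈ pisotModule θ := by
  simpa using nsmul_mem hθ.one_mem_pisotModule n

theorem exists_orbitCosProd_ne_zero (hθ : IsPisot θ) (hθ2 : θ ≠ 2) {D : ℕ} (hD : 0 < D) :
    ∃ d : ℕ, 0 < d ∧ orbitCosProd θ (D * d : ℕ) ≠ 0 := by
  obtain ⟨e, he⟩ := hθ.exists_mul_zpow_ne_odd hθ2 hD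
  refine ⟨2 ^ e, by positivity, SummableModOne.cosProd_ne_zero
    (summableModOne_mul_zpow hθ.1 (hθ.natCast_mem_pisotModule _)) fun j hj => ?_⟩
  obtain ⟨k, hk⟩ := Real.cos_eq_zero_iff.1 hj
  refine he j k (mul_left_cancel₀ Real.pi_ne_zero ?_)
  linarith

end IsPisot

/-- The group of all `ξ` such that `ξ θᴺ` is summably close both to `ℤ` and to `r ℤ`. -/
noncomputable def commonPisotModule (θ r : ℝ) : AddSubgroup ℝ :=
  pisotModule θ ⊓ (pisotModule θ).comap (AddMonoidHom.mulRight r⁻¹)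

section Infinite

variable {θ r ξ η : ℝ}

theorem mem_commonPisotModule :
    ξ ∈ commonPisotModule θ r ↔ ξ ∈ pisotModule θ ∧ ξ * r⁻¹ ∈ pisotModule θ :=
  Iff.rfl

theorem mul_pow_mem_commonPisotModule (h : ξ ∈ commonPisotModule θ r) (n : ℕ) :
    ξ * θ ^ n ∈ commonPisotModule θ r := by
  rw [mem_commonPisotModule] at h ⊢
  rw [mul_right_comm]
  exact ⟨mul_pow_mem_pisotModule h.1 n, mul_pow_mem_pisotModule h.2 n⟩

theorem orbitCosProd_mem_closure_range (hθ : 1 < θ) (hr : r ≠ 0)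
    (hξ : ξ ∈ commonPisotModule θ r) :
    orbitCosProd θ ξ ∈ closure (range fun n : ℤ => bernoulliFourier θ (r * n)) := by
  obtain ⟨K, hK⟩ := exists_lipschitzWith_bernoulliFourier hθ
  have hξr : SummableModOne fun N : ℕ => ξ * r⁻¹ * θ ^ N :=
    (mem_commonPisotModule.1 hξ).2
  have hround := hξr.summable_abs_sub_round.tendsto_atTop_zero
  have hdist : Tendsto
      (fun N : ℕ => dist (ξ * θ ^ N) (r * round (ξ * r⁻¹ * θ ^ N))) atTop (𝓝 0) := by
    have h := hround.const_mul |r|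
    rw [mul_zero] at h
    refine h.congr fun N => ?_
    rw [← abs_mul, Real.dist_eq, mul_sub]
    congr 2
    field_simp
  have hfourier : Tendsto (fun N : ℕ => dist (bernoulliFourier θ (ξ * θ ^ N))
      (bernoulliFourier θ (r * round (ξ * r⁻¹ * θ ^ N)))) atTop (𝓝 0) :=
    squeeze_zero (fun _ => dist_nonneg) (fun N => hK.dist_le_mul _ _)
      (by simpa using hdist.const_mul (K : ℝ))
  exact mem_closure_of_tendsto
    ((tendsto_bernoulliFourier_mul_pow hθ hξ.1).congr_dist hfourier)
    (Eventually.of_forall fun N => ⟨_, rfl⟩)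

theorem mul_mem_closure_image_orbitCosProd (hθ : 1 < θ) {x y : ℝ}
    (hx : x ∈ closure (orbitCosProd θ '' commonPisotModule θ r))
    (hy : y ∈ closure (orbitCosProd θ '' commonPisotModule θ r)) :
    x * y ∈ closure (orbitCosProd θ '' commonPisotModule θ r) := by
  rw [← closure_closure]
  refine map_mem_closure₂ continuous_mul hx hy ?_
  rintro _ ⟨ξ, hξ, rfl⟩ _ ⟨η, hη, rfl⟩
  exact mem_closure_of_tendsto (tendsto_orbitCosProd_add_mul_pow hθ hξ.1 hη.1)
    (Eventually.of_forall fun N =>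
      mem_image_of_mem _ (add_mem hξ (mul_pow_mem_commonPisotModule hη N)))

theorem accPt_sq_image_orbitCosProd (hθ : 1 < θ) (hξ : ξ ∈ commonPisotModule θ r)
    (hpos : 0 < ξ) (hne : orbitCosProd θ ξ ≠ 0) :
    AccPt (orbitCosProd θ ξ ^ 2) (𝓟 (orbitCosProd θ '' commonPisotModule θ r)) := by
  have hlim {η : ℝ} (hη : η ∈ commonPisotModule θ r) (h : orbitCosProd θ η = orbitCosProd θ ξ) :
      Tendsto (fun N : ℕ => orbitCosProd θ (ξ + η * θ ^ N)) atTop (𝓝 (orbitCosProd θ ξ ^ 2)) := by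
    simpa only [h, ← sq] using tendsto_orbitCosProd_add_mul_pow hθ hξ.1 hη.1
  have hneg : orbitCosProd θ (-ξ) = orbitCosProd θ ξ := by
    simpa only [orbitCosProd, neg_mul] using cosProd_neg fun j : ℤ => ξ * θ ^ j
  have hmem {η : ℝ} (hη : η ∈ commonPisotModule θ r) (N : ℕ) :
      orbitCosProd θ (ξ + η * θ ^ N) ∈ orbitCosProd θ '' commonPisotModule θ r :=
    mem_image_of_mem _ (add_mem hξ (mul_pow_mem_commonPisotModule hη N))
  rw [accPt_iff_frequently, frequently_iff]
  intro U hU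
  obtain ⟨N, ⟨hN, hN'⟩, h | h⟩ := (((hlim hξ rfl).eventually hU).and
    ((hlim (neg_mem hξ) hneg).eventually hU) |>.and
    (eventually_orbitCosProd_ne_sq hθ hξ.1 hpos hne)).exists
  · exact ⟨_, hN, h, hmem hξ N⟩
  · exact ⟨_, hN', h, hmem (neg_mem hξ) N⟩

theorem pow_add_two_mem_derivedSet (hθ : 1 < θ) (hr : r ≠ 0) (hξ : ξ ∈ commonPisotModule θ r)
    (hpos : 0 < ξ) (hne : orbitCosProd θ ξ ≠ 0) (k : ℕ) :
    orbitCosProd θ ξ ^ (k + 2) ∈ derivedSet (range fun n : ℤ => bernoulliFourier θ (r * n)) := by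
  set w := orbitCosProd θ ξ
  set G := orbitCosProd θ '' commonPisotModule θ r
  have hG : closure G ⊆ closure (range fun n : ℤ => bernoulliFourier θ (r * n)) := by
    refine closure_minimal ?_ isClosed_closure
    rintro _ ⟨η, hη, rfl⟩
    exact orbitCosProd_mem_closure_range hθ hr hη
  have hpow (x : ℝ) (hx : x ∈ closure G) : w ^ k * x ∈ closure G := by
    induction k with
    | zero => simpa using hx
    | succ k ih =>
      rw [pow_succ', mul_assoc]
      exact mul_mem_closure_image_orbitCosProd hθ (subset_closure (mem_image_of_mem _ hξ)) ih
  have hacc := (accPt_sq_image_orbitCosProd hθ hξ hpos hne).map (f := fun x => w ^ k * x)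
    (by fun_prop) (mul_right_injective₀ (pow_ne_zero k hne))
  rw [← derivedSet_closure, mem_derivedSet, pow_add]
  refine hacc.mono ?_
  rw [map_principal, le_principal_iff, mem_principal]
  rintro _ ⟨x, hx, rfl⟩
  exact hG (hpow x (subset_closure hx))

theorem IsPisot.infinite_derivedSet (hθ : IsPisot θ) (hθ2 : θ ≠ 2) (hr : r ≠ 0)
    (hrmem : r ∈ IntermediateField.adjoin ℚ {θ}) :
    (derivedSet (range fun n : ℤ => bernoulliFourier θ (r * n))).Infinite := by
  obtain ⟨D, hD, p, hp⟩ := exists_natCast_mul_eq_aeval hθ.isIntegral_rat.isAlgebraic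
    (inv_mem hrmem)
  obtain ⟨d, hd, hne⟩ := hθ.exists_orbitCosProd_ne_zero hθ2 hD
  have hmem : ((D * d : ℕ) : ℝ) ∈ commonPisotModule θ r := by
    refine mem_commonPisotModule.2 ⟨hθ.natCast_mem_pisotModule _, ?_⟩
    have heq : ((D * d : ℕ) : ℝ) * r⁻¹ = d • Polynomial.aeval θ p := by
      rw [← hp, nsmul_eq_mul]
      push_cast
      ring
    exact heq ▸ nsmul_mem (hθ.aeval_mem_pisotModule p) d
  have hpos : (0 : ℝ) < (D * d : ℕ) := by positivity
  refine infinite_of_injective_forall_mem (fun a b hab => ?_)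
    (pow_add_two_mem_derivedSet hθ.1 hr hmem hpos hne)
  have habs := congrArg abs hab
  simp only [abs_pow] at habs
  have := pow_right_injective₀ (abs_pos.2 hne) (abs_orbitCosProd_lt_one hθ.1 hmem.1 hpos).ne habs
  omega

end Infinite

/-! ### Discrete convolution and linear recurrences -/

/-- The shift operator on two-sided sequences; a polynomial in it is a linear recurrence. -/
def shiftEnd (R : Type*) [CommRing R] : Module.End R (ℤ → R) := LinearMap.funLeft R R (· + 1)

/-- The convolution of two-sided sequences. -/
noncomputable def seqConv {𝕜 : Type*} [RCLike 𝕜] (g d : ℤ → 𝕜) (k : ℤ) : 𝕜 :=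
  ∑' j, g (k - j) * d j

theorem shiftEnd_pow_apply {R : Type*} [CommRing R] (v : ℤ → R) (i : ℕ) (k : ℤ) :
    (shiftEnd R ^ i) v k = v (k + i) := by
  induction i generalizing k with
  | zero => simp
  | succ i ih =>
    rw [pow_succ', Module.End.mul_apply]
    change (shiftEnd R ^ i) v (k + 1) = _
    rw [ih, add_assoc, add_comm 1, Nat.cast_add_one]

theorem aeval_shiftEnd_apply {A R : Type*} [CommRing A] [CommRing R] [Algebra A R]
    (P : Polynomial A) (v : ℤ → R) (k : ℤ) :
    Polynomial.aeval (shiftEnd R) P v k =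
      ∑ i ∈ Finset.range (P.natDegree + 1), P.coeff i • v (k + i) := by
  simp only [Polynomial.aeval_eq_sum_range, LinearMap.sum_apply, Finset.sum_apply,
    LinearMap.smul_apply, Pi.smul_apply, shiftEnd_pow_apply]

theorem aeval_shiftEnd_one_sub_C_mul_X {R : Type*} [CommRing R] (α : R) (v : ℤ → R) (k : ℤ) :
    Polynomial.aeval (shiftEnd R) (1 - Polynomial.C α * Polynomial.X) v k =
      v k - α * v (k + 1) := by
  simp [shiftEnd, Algebra.algebraMap_eq_smul_one, LinearMap.funLeft]

theorem ofReal_aeval_shiftEnd (Q : Polynomial ℤ) (e : ℤ → ℝ) (k : ℤ) :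
    (Polynomial.aeval (shiftEnd ℝ) Q e k : ℂ) =
      Polynomial.aeval (shiftEnd ℂ) Q (fun j => (e j : ℂ)) k := by
  simp [aeval_shiftEnd_apply]

theorem re_aeval_shiftEnd (Q : Polynomial ℤ) (v : ℤ → ℂ) (k : ℤ) :
    (Polynomial.aeval (shiftEnd ℂ) Q v k).re =
      Polynomial.aeval (shiftEnd ℝ) Q (fun j => (v j).re) k := by
  simp [aeval_shiftEnd_apply]

section Convolution

variable {𝕜 : Type*} [RCLike 𝕜] {g d e : ℤ → 𝕜}

theorem seqConv_comm (g d : ℤ → 𝕜) : seqConv g d = seqConv d g := by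
  ext k
  rw [seqConv, seqConv, ← (Equiv.subLeft k).tsum_eq]
  simp [mul_comm]

theorem seqConv_single (e : ℤ → 𝕜) : seqConv (Pi.single 0 1) e = e := by
  ext k
  rw [seqConv, tsum_eq_single k]
  · simp
  · intro j hj
    simp [sub_eq_zero, hj.symm]

theorem aeval_shiftEnd_seqConv {A : Type*} [CommRing A] [Algebra A 𝕜] (P : Polynomial A)
    (h : ∀ k, Summable fun j => g (k - j) * d j) :
    Polynomial.aeval (shiftEnd 𝕜) P (seqConv g d) =
      seqConv (Polynomial.aeval (shiftEnd 𝕜) P g) d := by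
  ext k
  simp only [aeval_shiftEnd_apply, seqConv, Finset.sum_mul, smul_mul_assoc]
  simp only [Algebra.smul_def, ← tsum_mul_left]
  rw [Summable.tsum_finsetSum fun i _ => ?_]
  · simp only [sub_add_eq_add_sub]
  · simpa only [sub_add_eq_add_sub] using (h (k + i)).mul_left (algebraMap A 𝕜 (P.coeff i))

theorem summable_mul_of_norm_le (hg : Summable fun k => ‖g k‖) {R : ℝ} (hd : ∀ k, ‖d k‖ ≤ R)
    (k : ℤ) : Summable fun j => g (k - j) * d j := by
  refine Summable.of_norm_bounded
    ((hg.comp_injective (Equiv.subLeft k).injective).mul_right R) fun j => ?_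
  rw [norm_mul]
  exact mul_le_mul_of_nonneg_left (hd j) (norm_nonneg _)

theorem summable_norm_mul_norm_sub (hg : Summable fun k => ‖g k‖) (hd : Summable fun k => ‖d k‖) :
    Summable fun p : ℤ × ℤ => ‖g (p.1 - p.2) * d p.2‖ := by
  simp only [norm_mul]
  refine (hg.mul_of_nonneg hd (fun _ => norm_nonneg _) fun _ => norm_nonneg _).comp_injective
    (i := fun p : ℤ × ℤ => (p.1 - p.2, p.2)) fun p q h => ?_
  simp only [Prod.ext_iff] at h ⊢
  omega

theorem norm_seqConv_le (hg : Summable fun k => ‖g k‖) (hd : Summable fun k => ‖d k‖) (k : ℤ) :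
    ‖seqConv g d k‖ ≤ ∑' j, ‖g (k - j) * d j‖ :=
  norm_tsum_le_tsum_norm ((summable_norm_mul_norm_sub hg hd).prod_factor k)

theorem summable_norm_seqConv (hg : Summable fun k => ‖g k‖) (hd : Summable fun k => ‖d k‖) :
    Summable fun k => ‖seqConv g d k‖ :=
  (summable_norm_mul_norm_sub hg hd).prod.of_nonneg_of_le (fun _ => norm_nonneg _)
    (norm_seqConv_le hg hd)

theorem tsum_norm_seqConv_le (hg : Summable fun k => ‖g k‖) (hd : Summable fun k => ‖d k‖) :
    ∑' k, ‖seqConv g d k‖ ≤ (∑' k, ‖g k‖) * ∑' k, ‖d k‖ := by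
  have hprod := summable_norm_mul_norm_sub hg hd
  calc ∑' k, ‖seqConv g d k‖ ≤ ∑' k, ∑' j, ‖g (k - j) * d j‖ :=
        (summable_norm_seqConv hg hd).tsum_le_tsum (norm_seqConv_le hg hd) hprod.prod
    _ = ∑' j, ∑' k, ‖g (k - j) * d j‖ :=
        (Summable.tsum_comm (f := fun k j => ‖g (k - j) * d j‖) hprod).symm
    _ = (∑' k, ‖g k‖) * ∑' k, ‖d k‖ := by
        rw [← tsum_mul_left]
        refine tsum_congr fun j => ?_
        simp only [norm_mul, tsum_mul_right]
        rw [← (Equiv.subRight j).tsum_eq fun k => ‖g k‖]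
        rfl

theorem exists_norm_le_of_summable_norm (h : Summable fun k => ‖d k‖) : ∃ R, ∀ k, ‖d k‖ ≤ R :=
  ⟨∑' k, ‖d k‖, fun k => h.le_tsum k fun _ _ => norm_nonneg _⟩

theorem aeval_shiftEnd_seqConv_of_green {A : Type*} [CommRing A] [Algebra A 𝕜] {P : Polynomial A}
    (hg : Summable fun k => ‖g k‖) (hgreen : Polynomial.aeval (shiftEnd 𝕜) P g = Pi.single 0 1)
    {R : ℝ} (he : ∀ k, ‖e k‖ ≤ R) :
    Polynomial.aeval (shiftEnd 𝕜) P (seqConv g e) = e := by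
  rw [aeval_shiftEnd_seqConv P (summable_mul_of_norm_le hg he), hgreen, seqConv_single]

theorem seqConv_aeval_shiftEnd_of_green {A : Type*} [CommRing A] [Algebra A 𝕜] {P : Polynomial A}
    (hg : Summable fun k => ‖g k‖) (hgreen : Polynomial.aeval (shiftEnd 𝕜) P g = Pi.single 0 1)
    {R : ℝ} (he : ∀ k, ‖e k‖ ≤ R) :
    seqConv g (Polynomial.aeval (shiftEnd 𝕜) P e) = e := by
  have hsum (k : ℤ) : Summable fun j => e (k - j) * g j := by
    refine ((Equiv.subLeft k).summable_iff.2 (summable_mul_of_norm_le hg he k)).congr fun j => ?_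
    simp [mul_comm]
  rw [seqConv_comm, ← aeval_shiftEnd_seqConv P hsum, seqConv_comm,
    aeval_shiftEnd_seqConv_of_green hg hgreen he]

/-! ### Green functions of hyperbolic recurrences -/

theorem exists_green_one_sub_C_mul_X {α : 𝕜} (hα : ‖α‖ ≠ 1) :
    ∃ g : ℤ → 𝕜, (Summable fun k => ‖g k‖) ∧
      Polynomial.aeval (shiftEnd 𝕜) (1 - Polynomial.C α * Polynomial.X) g = Pi.single 0 1 := by
  rcases hα.lt_or_gt with hα | hα
  · refine ⟨fun k => if k ≤ 0 then α ^ k.natAbs else 0, Summable.of_nat_of_neg ?_ ?_, ?_⟩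
    · exact summable_of_ne_finset_zero (s := {0}) fun n hn => by simp_all
    · exact (summable_geometric_of_lt_one (norm_nonneg α) hα).congr fun n => by simp
    · ext k
      rw [aeval_shiftEnd_one_sub_C_mul_X]
      rcases lt_trichotomy k 0 with hk | rfl | hk
      · have hnat : k.natAbs = (k + 1).natAbs + 1 := by omega
        simp [hk.le, hk.ne, show k + 1 ≤ 0 by omega, hnat, pow_succ']
      · simp
      · simp [hk.not_ge, hk.ne', show ¬ k + 1 ≤ 0 by omega]
  · have hα0 : α ≠ 0 := norm_pos_iff.1 (zero_lt_one.trans hα)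
    refine ⟨fun k => if 0 < k then -(α⁻¹ ^ k.natAbs) else 0, Summable.of_nat_of_neg ?_ ?_, ?_⟩
    · refine (summable_geometric_of_lt_one (norm_nonneg α⁻¹) ?_).of_nonneg_of_le
        (fun _ => norm_nonneg _) fun n => ?_
      · rw [norm_inv]
        exact inv_lt_one_of_one_lt₀ hα
      · beta_reduce
        split_ifs <;> simp
    · exact summable_zero.congr fun n => by simp [(Int.natCast_nonneg n).not_gt]
    · ext k
      rw [aeval_shiftEnd_one_sub_C_mul_X]
      rcases lt_trichotomy k 0 with hk | rfl | hk
      · simp [hk.not_gt, hk.ne, show ¬ 0 < k + 1 by omega]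
      · simp [hα0]
      · have hnat : (k + 1).natAbs = k.natAbs + 1 := by omega
        simp [hk, hk.ne', show 0 < k + 1 by omega, hnat, pow_succ', hα0]

end Convolution

/-- The polynomial `∏ (1 - α X)` over the elements `α` of a multiset. -/
noncomputable def reciprocalPoly (s : Multiset ℂ) : Polynomial ℂ :=
  (s.map fun α => 1 - Polynomial.C α * Polynomial.X).prod

theorem reciprocalPoly_cons (α : ℂ) (s : Multiset ℂ) :
    reciprocalPoly (α ::ₘ s) = (1 - Polynomial.C α * Polynomial.X) * reciprocalPoly s := by
  rw [reciprocalPoly, Multiset.map_cons, Multiset.prod_cons, reciprocalPoly]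

theorem exists_green_reciprocalPoly (s : Multiset ℂ) (hs : ∀ α ∈ s, ‖α‖ ≠ 1) :
    ∃ g : ℤ → ℂ, (Summable fun k => ‖g k‖) ∧
      Polynomial.aeval (shiftEnd ℂ) (reciprocalPoly s) g = Pi.single 0 1 := by
  induction s using Multiset.induction_on with
  | empty =>
    refine ⟨Pi.single 0 1, summable_of_ne_finset_zero (s := {0}) fun k hk => ?_, ?_⟩
    · simp_all
    · simp [reciprocalPoly]
  | cons α s ih =>
    obtain ⟨g, hg, hgreen⟩ := ih fun β hβ => hs β (Multiset.mem_cons_of_mem hβ)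
    obtain ⟨f, hf, hfgreen⟩ := exists_green_one_sub_C_mul_X (hs α (Multiset.mem_cons_self α s))
    obtain ⟨R, hR⟩ := exists_norm_le_of_summable_norm hf
    refine ⟨seqConv g f, summable_norm_seqConv hg hf, ?_⟩
    rw [reciprocalPoly_cons, map_mul, Module.End.mul_apply,
      aeval_shiftEnd_seqConv_of_green hg hgreen hR, hfgreen]

theorem exists_green_of_map_eq_reciprocalPoly {Q : Polynomial ℤ} {s : Multiset ℂ}
    (hQ : Q.map (algebraMap ℤ ℂ) = reciprocalPoly s) (hs : ∀ α ∈ s, ‖α‖ ≠ 1) :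
    ∃ g : ℤ → ℝ, (Summable fun k => ‖g k‖) ∧
      Polynomial.aeval (shiftEnd ℝ) Q g = Pi.single 0 1 := by
  obtain ⟨g, hg, hgreen⟩ := exists_green_reciprocalPoly s hs
  rw [← hQ, Polynomial.aeval_map_algebraMap] at hgreen
  refine ⟨fun k => (g k).re, hg.of_nonneg_of_le (fun _ => norm_nonneg _)
    fun k => Complex.abs_re_le_norm _, ?_⟩
  ext k
  rw [← re_aeval_shiftEnd, hgreen, Pi.single_apply, Pi.single_apply]
  split_ifs <;> simp

theorem eq_zero_of_eq_mul_succ {α : ℂ} (hα : ‖α‖ < 1) {v : ℤ → ℂ} {R : ℝ} (hv : ∀ k, ‖v k‖ ≤ R)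
    (h : ∀ k, 0 ≤ k → v k = α * v (k + 1)) {k : ℤ} (hk : 0 ≤ k) : v k = 0 := by
  have hpow (n : ℕ) : v k = α ^ n * v (k + n) := by
    induction n with
    | zero => simp
    | succ n ih => rw [ih, h (k + n) (by omega), pow_succ, mul_assoc, Nat.cast_add_one, add_assoc]
  have hlim : Tendsto (fun n : ℕ => ‖α‖ ^ n * R) atTop (𝓝 0) := by
    simpa using (tendsto_pow_atTop_nhds_zero_of_lt_one (norm_nonneg _) hα).mul_const R
  refine norm_le_zero_iff.1 (ge_of_tendsto' hlim fun n => ?_)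
  rw [hpow n, norm_mul, norm_pow]
  exact mul_le_mul_of_nonneg_left (hv _) (by positivity)

theorem norm_aeval_shiftEnd_one_sub_C_mul_X_le (α : ℂ) {v : ℤ → ℂ} {R : ℝ} (hv : ∀ k, ‖v k‖ ≤ R)
    (k : ℤ) : ‖Polynomial.aeval (shiftEnd ℂ) (1 - Polynomial.C α * Polynomial.X) v k‖ ≤
      R + ‖α‖ * R := by
  rw [aeval_shiftEnd_one_sub_C_mul_X]
  refine (norm_sub_le _ _).trans (add_le_add (hv k) ?_)
  rw [norm_mul]
  exact mul_le_mul_of_nonneg_left (hv _) (norm_nonneg _)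

theorem eq_zero_of_aeval_reciprocalPoly_eq_zero (s : Multiset ℂ) (hs : ∀ α ∈ s, ‖α‖ < 1)
    {v : ℤ → ℂ} {R : ℝ} (hv : ∀ k, ‖v k‖ ≤ R)
    (h : ∀ k, 0 ≤ k → Polynomial.aeval (shiftEnd ℂ) (reciprocalPoly s) v k = 0)
    {k : ℤ} (hk : 0 ≤ k) : v k = 0 := by
  induction s using Multiset.induction_on generalizing v R k with
  | empty => simpa [reciprocalPoly] using h k hk
  | cons α s ih =>
    refine eq_zero_of_eq_mul_succ (hs α (Multiset.mem_cons_self α s)) hv (fun k hk => ?_) hk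
    rw [← sub_eq_zero, ← aeval_shiftEnd_one_sub_C_mul_X]
    refine ih (fun β hβ => hs β (Multiset.mem_cons_of_mem hβ))
      (norm_aeval_shiftEnd_one_sub_C_mul_X_le α hv) (fun k hk => ?_) hk
    rw [← Module.End.mul_apply, ← map_mul, mul_comm, ← reciprocalPoly_cons, h k hk]

theorem eq_mul_inv_pow_of_aeval_shiftEnd_eq_zero {θ : ℝ} (hθ : θ ≠ 0) {Q : Polynomial ℤ}
    {s : Multiset ℂ} (hQ : Q.map (algebraMap ℤ ℂ) = reciprocalPoly ((θ : ℂ) ::ₘ s))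
    (hs : ∀ α ∈ s, ‖α‖ < 1) {e : ℤ → ℝ} {R : ℝ} (he : ∀ k, |e k| ≤ R)
    (h : ∀ k, 0 ≤ k → Polynomial.aeval (shiftEnd ℝ) Q e k = 0) (n : ℕ) :
    e n = e 0 * θ⁻¹ ^ n := by
  have hrec (k : ℤ) (hk : 0 ≤ k) : e k = θ * e (k + 1) := by
    have hzero := eq_zero_of_aeval_reciprocalPoly_eq_zero s hs
      (norm_aeval_shiftEnd_one_sub_C_mul_X_le θ (v := fun j => (e j : ℂ)) (R := R)
        fun k => (Complex.norm_real _).trans_le (he k)) (fun k hk => ?_) hk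
    · rw [aeval_shiftEnd_one_sub_C_mul_X, sub_eq_zero] at hzero
      exact_mod_cast hzero
    · rw [← Module.End.mul_apply, ← map_mul, mul_comm, ← reciprocalPoly_cons, ← hQ,
        Polynomial.aeval_map_algebraMap, ← ofReal_aeval_shiftEnd, h k hk, Complex.ofReal_zero]
  induction n with
  | zero => simp
  | succ n ih =>
    rw [pow_succ, ← mul_assoc, ← ih, hrec n (by omega), Nat.cast_add_one]
    field_simp

theorem reverse_X_sub_C {R : Type*} [CommRing R] [Nontrivial R] (α : R) :
    (Polynomial.X - Polynomial.C α).reverse = 1 - Polynomial.C α * Polynomial.X := by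
  have h : Polynomial.X - Polynomial.C α = 1 * Polynomial.X + Polynomial.C (-α) := by
    rw [map_neg]
    ring
  rw [h, Polynomial.reverse_add_C, Polynomial.reverse_mul_X, ← Polynomial.C_1,
    Polynomial.reverse_C, map_one, one_mul, Polynomial.natDegree_X, pow_one, map_neg]
  ring

theorem reverse_prod_X_sub_C (s : Multiset ℂ) :
    (s.map fun α => Polynomial.X - Polynomial.C α).prod.reverse = reciprocalPoly s := by
  induction s using Multiset.induction_on with
  | empty => simpa [reciprocalPoly] using Polynomial.reverse_C (1 : ℂ)
  | cons α s ih =>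
    rw [Multiset.map_cons, Multiset.prod_cons, Polynomial.reverse_mul_of_domain, ih,
      reverse_X_sub_C, reciprocalPoly_cons]

theorem IsPisot.exists_map_eq_reciprocalPoly {θ : ℝ} (hθ : IsPisot θ) :
    ∃ (Q : Polynomial ℤ) (s : Multiset ℂ), Q.map (algebraMap ℤ ℂ) = reciprocalPoly ((θ : ℂ) ::ₘ s) ∧
      Polynomial.aeval θ⁻¹ Q = 0 ∧ ∀ α ∈ s, ‖α‖ < 1 := by
  obtain ⟨s, hs, hs1⟩ := hθ.exists_map_minpoly_eq
  refine ⟨(minpoly ℤ θ).reverse, s, ?_, ?_, hs1⟩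
  · have hmap : (minpoly ℤ θ).map (algebraMap ℤ ℂ) = (minpoly ℚ θ).map (algebraMap ℚ ℂ) := by
      rw [minpoly.isIntegrallyClosed_eq_field_fractions' ℚ hθ.2.1, Polynomial.map_map,
        ← IsScalarTower.algebraMap_eq]
    rw [Polynomial.reverse, ← Polynomial.natDegree_map_eq_of_injective
      (algebraMap ℤ ℂ).injective_int (minpoly ℤ θ), ← Polynomial.reflect_map, hmap,
      ← Polynomial.reverse, hs, ← reverse_prod_X_sub_C, Multiset.map_cons, Multiset.prod_cons]
  · have := invertibleOfNonzero (zero_lt_one.trans hθ.1).ne'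
    rw [← invOf_eq_inv]
    exact (Polynomial.eval₂_reverse_eq_zero_iff _ _ _).2 (minpoly.aeval ℤ θ)

/-! ### Limits of products over two-sided blocks -/

section AbsSum

variable {ι : Type*}

/-- The `ℓ¹` norm of a finitely supported integer sequence, as a natural number: the quantity
which decreases when a limiting block is split off. -/
def absSum (d : ι →₀ ℤ) : ℕ := d.sum fun _ n => n.natAbs

theorem absSum_eq_sum {d : ι →₀ ℤ} {s : Finset ι} (hs : d.support ⊆ s) :
    absSum d = ∑ i ∈ s, (d i).natAbs :=
  Finsupp.sum_of_support_subset d hs _ fun _ _ => rfl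

theorem sum_natAbs_le_absSum (d : ι →₀ ℤ) (s : Finset ι) : ∑ i ∈ s, (d i).natAbs ≤ absSum d := by
  classical
  rw [absSum_eq_sum (Finset.subset_union_left (s₂ := s))]
  exact Finset.sum_le_sum_of_subset Finset.subset_union_right

theorem natAbs_le_absSum (d : ι →₀ ℤ) (i : ι) : (d i).natAbs ≤ absSum d := by
  simpa using sum_natAbs_le_absSum d {i}

theorem absSum_eq_zero_iff {d : ι →₀ ℤ} : absSum d = 0 ↔ d = 0 := by
  refine ⟨fun h => Finsupp.ext fun i => Int.natAbs_eq_zero.1 ?_, fun h => by simp [h, absSum]⟩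
  exact Nat.le_zero.1 (h ▸ natAbs_le_absSum d i)

theorem absSum_sub_add_absSum {c d : ι →₀ ℤ} (h : ∀ i ∈ c.support, d i = c i) :
    absSum (d - c) + absSum c = absSum d := by
  classical
  rw [absSum_eq_sum (s := d.support ∪ c.support) Finsupp.support_sub,
    absSum_eq_sum (Finset.subset_union_right (s₁ := d.support)),
    absSum_eq_sum (Finset.subset_union_left (s₂ := c.support)), ← Finset.sum_add_distrib]
  refine Finset.sum_congr rfl fun i _ => ?_
  by_cases hi : i ∈ c.support
  · simp [h i hi]
  · simp [Finsupp.notMem_support_iff.1 hi]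

theorem hasSum_norm_intCast (d : ι →₀ ℤ) : HasSum (fun i => ‖(d i : ℝ)‖) (absSum d) := by
  rw [absSum_eq_sum subset_rfl, Nat.cast_sum]
  simp only [Nat.cast_natAbs, Int.cast_abs, Real.norm_eq_abs]
  exact hasSum_sum_of_ne_finset_zero fun i hi => by simpa using hi

theorem exists_finsupp_of_sum_natAbs_le {c : ι → ℤ} {M : ℕ}
    (hc : ∀ s : Finset ι, ∑ i ∈ s, (c i).natAbs ≤ M) : ∃ d : ι →₀ ℤ, absSum d ≤ M ∧ ⇑d = c := by
  have hsum : Summable fun i => ‖c i‖ := by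
    refine summable_of_sum_le (c := M) (fun i => norm_nonneg _) fun s => ?_
    simpa [Int.norm_eq_abs] using Nat.cast_le (α := ℝ).2 (hc s)
  exact ⟨Finsupp.ofSupportFinite c hsum.of_norm.hasFiniteSupport_of_discreteTopology, hc _, rfl⟩

theorem exists_finsupp_eventually_eq {X : Type*} {u : Ultrafilter X} {d : X → ι →₀ ℤ} {M : ℕ}
    (hd : ∀ᶠ x in u, absSum (d x) ≤ M) :
    ∃ c : ι →₀ ℤ, absSum c ≤ M ∧ ∀ i, ∀ᶠ x in u, d x i = c i := by
  have hval (i : ι) : ∃ n : ℤ, ∀ᶠ x in u, d x i = n := by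
    have hmem : ∀ᶠ x in u, ∃ n ∈ Icc (-M : ℤ) M, d x i = n := by
      filter_upwards [hd] with x hx
      have := natAbs_le_absSum (d x) i
      exact ⟨d x i, by rw [mem_Icc]; omega, rfl⟩
    obtain ⟨n, -, hn⟩ := (Ultrafilter.eventually_exists_mem_iff (finite_Icc _ _)).1 hmem
    exact ⟨n, hn⟩
  choose c hc using hval
  obtain ⟨c', hc'M, rfl⟩ := exists_finsupp_of_sum_natAbs_le (c := c) (M := M) fun s => by
    obtain ⟨x, hx, hxc⟩ := (hd.and ((Finset.eventually_all s).2 fun i _ => hc i)).exists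
    rw [← Finset.sum_congr rfl fun i hi => congrArg Int.natAbs (hxc i hi)]
    exact (sum_natAbs_le_absSum (d x) s).trans hx
  exact ⟨c', hc'M, hc⟩

end AbsSum

/-- The absolute value of the product of the cosines of `π e k` over `k : ℤ`. -/
noncomputable def blockValue (e : ℤ → ℝ) : ℝ := |cosProd fun k => e k / 2|

section BlockValue

variable {a b : ℤ → ℝ}

theorem summableModOne_div_two (ha : Summable fun k => ‖a k‖) :
    SummableModOne fun k => a k / 2 := by
  refine SummableModOne.of_summable_abs ((ha.div_const 2).congr fun k => ?_)
  rw [abs_div, abs_two, Real.norm_eq_abs]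

theorem blockValue_comp_add_right (e : ℤ → ℝ) (j : ℤ) :
    blockValue (fun k => e (k + j)) = blockValue e :=
  congrArg abs (cosProd_comp_equiv (Equiv.addRight j) fun k => e k / 2)

theorem blockValue_mem_Icc (ha : Summable fun k => ‖a k‖) : blockValue a ∈ Icc 0 1 :=
  ⟨abs_nonneg _, (summableModOne_div_two ha).abs_cosProd_le_one⟩

theorem abs_blockValue_sub_le (ha : Summable fun k => ‖a k‖) (hb : Summable fun k => ‖b k‖) :
    |blockValue a - blockValue b| ≤ π * ∑' k, ‖a k - b k‖ := by
  have hterm (k : ℤ) : |a k / 2 - b k / 2| = ‖a k - b k‖ / 2 := by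
    rw [← sub_div, abs_div, abs_two, Real.norm_eq_abs]
  refine (abs_abs_sub_abs_le_abs_sub _ _).trans
    (((summableModOne_div_two ha).abs_cosProd_sub_le (summableModOne_div_two hb) ?_).trans_eq ?_)
  · simp only [hterm]
    exact ((ha.add hb).of_nonneg_of_le (fun _ => norm_nonneg _)
      fun k => norm_sub_le _ _).div_const 2
  · simp only [hterm, tsum_div_const]
    ring

theorem tendsto_blockValue_add_sub_mul {X : Type*} {l : Filter X} {b : X → ℤ → ℝ}
    (ha : Summable fun k => ‖a k‖) (hb : ∀ᶠ x in l, Summable fun k => ‖b x k‖)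
    (hb0 : ∀ k, Tendsto (fun x => b x k) l (𝓝 0)) :
    Tendsto (fun x => blockValue (a + b x) - blockValue a * blockValue (b x)) l (𝓝 0) := by
  have ha' := summableModOne_div_two ha
  have hlim : Tendsto (fun x => ∑' k, |Real.sin (2 * π * (a k / 2)) *
      Real.sin (2 * π * (b x k / 2))|) l (𝓝 0) := by
    rw [← tsum_zero (α := ℝ) (β := ℤ)]
    refine tendsto_tsum_of_dominated_convergence ha'.summable_abs_sin (fun k => ?_)
      (Eventually.of_forall fun x k => ?_)
    · simpa using ((Real.continuous_sin.tendsto _).comp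
        (((hb0 k).div_const 2).const_mul (2 * π))).const_mul (Real.sin (2 * π * (a k / 2))) |>.abs
    · rw [Real.norm_eq_abs, abs_abs, abs_mul]
      exact mul_le_of_le_one_right (abs_nonneg _) (Real.abs_sin_le_one _)
  refine squeeze_zero_norm' ?_ hlim
  filter_upwards [hb] with x hx
  rw [Real.norm_eq_abs, blockValue, blockValue, blockValue, ← abs_mul]
  simpa only [Pi.add_apply, add_div] using (abs_abs_sub_abs_le_abs_sub _ _).trans
    (ha'.abs_cosProd_add_sub_mul_le (summableModOne_div_two hx))

theorem exists_tendsto_blockValue {X : Type*} {u : Ultrafilter X} {b : X → ℤ → ℝ}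
    (hb : ∀ᶠ x in u, Summable fun k => ‖b x k‖) :
    ∃ y, Tendsto (fun x => blockValue (b x)) u (𝓝 y) := by
  obtain ⟨y, -, hy⟩ := isCompact_Icc.ultrafilter_le_nhds (u.map fun x => blockValue (b x))
    (le_principal_iff.2 (hb.mono fun x hx => blockValue_mem_Icc hx))
  exact ⟨y, hy⟩

end BlockValue

theorem seqConv_sub {𝕜 : Type*} [RCLike 𝕜] {g d e : ℤ → 𝕜} (hg : Summable fun k => ‖g k‖)
    {R S : ℝ} (hd : ∀ k, ‖d k‖ ≤ R) (he : ∀ k, ‖e k‖ ≤ S) :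
    seqConv g (d - e) = seqConv g d - seqConv g e := by
  ext k
  simp only [seqConv, Pi.sub_apply, mul_sub]
  exact (summable_mul_of_norm_le hg hd k).tsum_sub (summable_mul_of_norm_le hg he k)

theorem tendsto_seqConv_zero {𝕜 : Type*} [RCLike 𝕜] {X : Type*} {l : Filter X} {g : ℤ → 𝕜}
    {d : X → ℤ → 𝕜} (hg : Summable fun k => ‖g k‖) {R : ℝ} (hd : ∀ᶠ x in l, ∀ k, ‖d x k‖ ≤ R)
    (hd0 : ∀ k, Tendsto (fun x => d x k) l (𝓝 0)) (k : ℤ) :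
    Tendsto (fun x => seqConv g (d x) k) l (𝓝 0) := by
  rw [← tsum_zero (α := 𝕜) (β := ℤ)]
  refine tendsto_tsum_of_dominated_convergence
    ((hg.comp_injective (Equiv.subLeft k).injective).mul_right R) (fun j => ?_)
    (hd.mono fun x hx j => ?_)
  · simpa using (hd0 j).const_mul (g (k - j))
  · rw [norm_mul]
    exact mul_le_mul_of_nonneg_left (hx j) (norm_nonneg _)

/-- The block value of the convolution of `g` with a finitely supported integer sequence. -/
noncomputable def convBlockValue (g : ℤ → ℝ) (d : ℤ →₀ ℤ) : ℝ :=
  blockValue (seqConv g fun k => (d k : ℝ))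

/-- The multiplicative monoid generated by the block values of the convolutions of `g` with
finitely supported integer sequences. -/
def blockMonoid (g : ℤ → ℝ) : Submonoid ℝ := Submonoid.closure (range (convBlockValue g))

theorem countable_blockMonoid (g : ℤ → ℝ) : (blockMonoid g : Set ℝ).Countable := by
  rw [blockMonoid, ← FreeMonoid.mrange_lift, MonoidHom.coe_mrange]
  exact countable_range _

theorem convBlockValue_equivMapDomain_subRight (g : ℤ → ℝ) (d : ℤ →₀ ℤ) (j : ℤ) :
    convBlockValue g (Finsupp.equivMapDomain (Equiv.subRight j) d) = convBlockValue g d := by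
  rw [convBlockValue, convBlockValue,
    ← blockValue_comp_add_right (seqConv g fun k => (d k : ℝ)) j]
  congr 1
  ext k
  rw [seqConv, seqConv, ← (Equiv.addRight j).tsum_eq fun i => g (k + j - i) * d i]
  simp

theorem exists_translate_apply_zero_ne_zero (g : ℤ → ℝ) (d : ℤ →₀ ℤ) :
    ∃ d' : ℤ →₀ ℤ, (d ≠ 0 → d' 0 ≠ 0) ∧ absSum d' = absSum d ∧
      convBlockValue g d' = convBlockValue g d := by
  rcases eq_or_ne d 0 with rfl | hd
  · exact ⟨0, by simp⟩
  · obtain ⟨j, hj⟩ := Finsupp.ne_iff.1 hd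
    exact ⟨Finsupp.equivMapDomain (Equiv.subRight j) d, fun _ => by simpa using hj,
      Finsupp.sum_equivMapDomain _ _ _, convBlockValue_equivMapDomain_subRight g d j⟩

section

variable {g : ℤ → ℝ}

theorem summable_norm_seqConv_intCast (hg : Summable fun k => ‖g k‖) (d : ℤ →₀ ℤ) :
    Summable fun k => ‖seqConv g (fun j => (d j : ℝ)) k‖ :=
  summable_norm_seqConv hg (hasSum_norm_intCast d).summable

theorem norm_intCast_le_absSum (d : ℤ →₀ ℤ) (k : ℤ) : ‖(d k : ℝ)‖ ≤ absSum d :=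
  le_hasSum (hasSum_norm_intCast d) k fun _ _ => norm_nonneg _

theorem tendsto_convBlockValue_sub_mul (hg : Summable fun k => ‖g k‖) {X : Type*} {l : Filter X}
    {d : X → ℤ →₀ ℤ} {M : ℕ} {c : ℤ →₀ ℤ} (hd : ∀ᶠ x in l, absSum (d x - c) ≤ M)
    (hc : ∀ k, ∀ᶠ x in l, d x k = c k) :
    Tendsto (fun x => convBlockValue g (d x) - convBlockValue g c * convBlockValue g (d x - c))
      l (𝓝 0) := by
  have hlim := tendsto_blockValue_add_sub_mul (summable_norm_seqConv_intCast hg c)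
    (Eventually.of_forall fun x => summable_norm_seqConv_intCast hg (d x - c))
    (tendsto_seqConv_zero (l := l) hg (R := M) ?_ fun k => ?_)
  · refine hlim.congr fun x => ?_
    have hsub : seqConv g (fun k => ((d x - c) k : ℝ)) =
        seqConv g (fun k => (d x k : ℝ)) - seqConv g fun k => (c k : ℝ) := by
      rw [← seqConv_sub hg (norm_intCast_le_absSum _) (norm_intCast_le_absSum _)]
      congr 1
      ext k
      simp
    rw [convBlockValue, convBlockValue, convBlockValue, hsub, add_sub_cancel]
  · filter_upwards [hd] with x hx k using (norm_intCast_le_absSum _ k).trans (Nat.cast_le.2 hx)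
  · refine tendsto_const_nhds.congr' ?_
    filter_upwards [hc k] with x hx
    simp [hx]

-- Translate the blocks so that they do not vanish at `0`. The pointwise limit `c` is then nonzero
-- and splitting it off decreases `absSum`, while the remainder moves off to infinity.
theorem mem_blockMonoid_of_tendsto (hg : Summable fun k => ‖g k‖) {X : Type*} {u : Ultrafilter X}
    {M : ℕ} {d : X → ℤ →₀ ℤ} (hd : ∀ᶠ x in u, absSum (d x) ≤ M) {z : ℝ}
    (hz : Tendsto (fun x => convBlockValue g (d x)) u (𝓝 z)) : z ∈ blockMonoid g := by
  induction M generalizing d z with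
  | zero =>
    have hone : z = 1 := by
      refine tendsto_nhds_unique hz (tendsto_const_nhds.congr' ?_)
      filter_upwards [hd] with x hx
      simp [absSum_eq_zero_iff.1 (Nat.le_zero.1 hx), convBlockValue, seqConv, blockValue, cosProd]
    exact hone ▸ one_mem _
  | succ M ih =>
    by_cases hzero : ∀ᶠ x in u, d x = 0
    · exact ih (hzero.mono fun x hx => by simp [hx, absSum]) hz
    rw [← Ultrafilter.eventually_not] at hzero
    choose d' hd'0 hd'abs hd'val using fun x => exists_translate_apply_zero_ne_zero g (d x)
    simp only [← hd'abs, ← hd'val] at hd hz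
    obtain ⟨c, -, hc⟩ := exists_finsupp_eventually_eq hd
    have hc1 : 1 ≤ absSum c := by
      obtain ⟨x, hx, hxc⟩ := (hzero.and (hc 0)).exists
      have := natAbs_le_absSum c 0
      have := hd'0 x hx
      omega
    have hsub : ∀ᶠ x in u, absSum (d' x - c) ≤ M := by
      filter_upwards [hd, (Finset.eventually_all c.support).2 fun k _ => hc k] with x hx hxc
      have := absSum_sub_add_absSum hxc
      omega
    obtain ⟨y, hy⟩ := exists_tendsto_blockValue
      (.of_forall fun x => summable_norm_seqConv_intCast hg (d' x - c) : ∀ᶠ x in u, _)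
    have hprod : z - convBlockValue g c * y = 0 :=
      tendsto_nhds_unique (hz.sub (hy.const_mul _)) (tendsto_convBlockValue_sub_mul hg hsub hc)
    rw [sub_eq_zero.1 hprod]
    exact mul_mem (Submonoid.subset_closure ⟨c, rfl⟩) (ih hsub hy)

end

/-! ### Limits of products over half-line sequences -/

theorem absSum_sub_le {ι : Type*} (c d : ι →₀ ℤ) : absSum (c - d) ≤ absSum c + absSum d := by
  classical
  rw [absSum_eq_sum (s := c.support ∪ d.support) Finsupp.support_sub,
    absSum_eq_sum (Finset.subset_union_left (s₂ := d.support)),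
    absSum_eq_sum (Finset.subset_union_right (s₁ := c.support)), ← Finset.sum_add_distrib]
  exact Finset.sum_le_sum fun i _ => Int.natAbs_sub_le _ _

/-- Sequences on the nonnegative integers, extended by zero and bounded by `R`, which solve the
recurrence `Q` up to an integer source of `ℓ¹` norm at most `M`, together with an integrality
condition at `0` given by `h`. -/
def halfSeqs (Q h : Polynomial ℤ) (R : ℝ) (M : ℕ) : Set (ℤ → ℝ) :=
  {e | (∀ k < 0, e k = 0) ∧ (∀ k, ‖e k‖ ≤ R) ∧
    (∃ c : ℤ →₀ ℤ, absSum c ≤ M ∧ (∀ k < 0, c k = 0) ∧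
      ∀ k, 0 ≤ k → Polynomial.aeval (shiftEnd ℝ) Q e k = c k) ∧
    ∃ m : ℤ, Polynomial.aeval (shiftEnd ℝ) h e 0 = m}

section HalfSeqs

variable {Q h : Polynomial ℤ} {R : ℝ} {M : ℕ} {b e e' : ℤ → ℝ} {c : ℤ →₀ ℤ}

theorem sub_mem_halfSeqs (he : e ∈ halfSeqs Q h R M) (he' : e' ∈ halfSeqs Q h R M) :
    e - e' ∈ halfSeqs Q h (R + R) (M + M) := by
  obtain ⟨he0, heR, ⟨c, hcM, hc0, hc⟩, m, hm⟩ := he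
  obtain ⟨he'0, he'R, ⟨c', hcM', hc'0, hc'⟩, m', hm'⟩ := he'
  refine ⟨fun k hk => by simp [he0 k hk, he'0 k hk],
    fun k => (norm_sub_le _ _).trans (add_le_add (heR k) (he'R k)),
    ⟨c - c', (absSum_sub_le c c').trans (add_le_add hcM hcM'),
      fun k hk => by simp [hc0 k hk, hc'0 k hk], fun k hk => ?_⟩, m - m', ?_⟩
  · simp [hc k hk, hc' k hk]
  · simp [hm, hm']

theorem aeval_shiftEnd_eq_zero_of_lt (hb : ∀ k < 0, b k = 0) {k : ℤ}
    (hk : k < -(Q.natDegree : ℤ)) : Polynomial.aeval (shiftEnd ℝ) Q b k = 0 := by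
  rw [aeval_shiftEnd_apply]
  refine Finset.sum_eq_zero fun i hi => ?_
  rw [Finset.mem_range] at hi
  rw [hb _ (by omega), smul_zero]

theorem hasSum_norm_aeval_shiftEnd_sub (hb : ∀ k < 0, b k = 0) (hc0 : ∀ k < 0, c k = 0)
    (hc : ∀ k, 0 ≤ k → Polynomial.aeval (shiftEnd ℝ) Q b k = c k) :
    HasSum (fun k => ‖(Polynomial.aeval (shiftEnd ℝ) Q b - fun j => (c j : ℝ)) k‖)
      (∑ k ∈ Finset.Ico (-(Q.natDegree : ℤ)) 0, ‖Polynomial.aeval (shiftEnd ℝ) Q b k‖) := by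
  have hIco : ∀ k ∈ Finset.Ico (-(Q.natDegree : ℤ)) 0, ‖Polynomial.aeval (shiftEnd ℝ) Q b k‖ =
      ‖(Polynomial.aeval (shiftEnd ℝ) Q b - fun j => (c j : ℝ)) k‖ := fun k hk => by
    simp [hc0 k (Finset.mem_Ico.1 hk).2]
  rw [Finset.sum_congr rfl hIco]
  refine hasSum_sum_of_ne_finset_zero fun k hk => ?_
  rw [Finset.mem_Ico, not_and_or, not_le, not_lt] at hk
  rcases hk with hk | hk
  · simp [aeval_shiftEnd_eq_zero_of_lt hb hk, hc0 k (by omega)]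
  · simp [hc k hk]

theorem summable_norm_aeval_shiftEnd (he : e ∈ halfSeqs Q h R M) :
    Summable fun k => ‖Polynomial.aeval (shiftEnd ℝ) Q e k‖ := by
  obtain ⟨he0, -, ⟨c, -, hc0, hc⟩, -⟩ := he
  refine ((hasSum_norm_aeval_shiftEnd_sub he0 hc0 hc).summable.add
    (hasSum_norm_intCast c).summable).of_nonneg_of_le (fun _ => norm_nonneg _) fun k => ?_
  simpa using norm_add_le ((Polynomial.aeval (shiftEnd ℝ) Q e - fun j => (c j : ℝ)) k) (c k)

variable {g : ℤ → ℝ}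

theorem summable_norm_of_mem_halfSeqs (hg : Summable fun k => ‖g k‖)
    (hgreen : Polynomial.aeval (shiftEnd ℝ) Q g = Pi.single 0 1) (he : e ∈ halfSeqs Q h R M) :
    Summable fun k => ‖e k‖ := by
  rw [← seqConv_aeval_shiftEnd_of_green hg hgreen he.2.1]
  exact summable_norm_seqConv hg (summable_norm_aeval_shiftEnd he)

theorem exists_abs_blockValue_sub_convBlockValue_le (hg : Summable fun k => ‖g k‖)
    (hgreen : Polynomial.aeval (shiftEnd ℝ) Q g = Pi.single 0 1) (he : e ∈ halfSeqs Q h R M) :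
    ∃ d : ℤ →₀ ℤ, absSum d ≤ M ∧ |blockValue e - convBlockValue g d| ≤ π * ((∑' k, ‖g k‖) *
      ∑ k ∈ Finset.Ico (-(Q.natDegree : ℤ)) 0, ‖Polynomial.aeval (shiftEnd ℝ) Q e k‖) := by
  obtain ⟨S, hS⟩ := exists_norm_le_of_summable_norm (summable_norm_aeval_shiftEnd he)
  have hsummable := summable_norm_of_mem_halfSeqs hg hgreen he
  obtain ⟨he0, heR, ⟨d, hdM, hd0, hd⟩, -⟩ := he
  have hdiff := hasSum_norm_aeval_shiftEnd_sub he0 hd0 hd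
  refine ⟨d, hdM, (abs_blockValue_sub_le hsummable (summable_norm_seqConv_intCast hg d)).trans
    (mul_le_mul_of_nonneg_left ?_ Real.pi_pos.le)⟩
  have hconv := seqConv_sub hg hS (norm_intCast_le_absSum d)
  rw [seqConv_aeval_shiftEnd_of_green hg hgreen heR] at hconv
  simp only [← Pi.sub_apply, ← hconv, ← hdiff.tsum_eq]
  exact tsum_norm_seqConv_le hg hdiff.summable

theorem eq_zero_of_aeval_shiftEnd_eq_zero {θ : ℝ} (hθ : θ ≠ 0) {s : Multiset ℂ}
    (hQ : Q.map (algebraMap ℤ ℂ) = reciprocalPoly ((θ : ℂ) ::ₘ s)) (hs : ∀ α ∈ s, ‖α‖ < 1)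
    (hh : Polynomial.aeval θ⁻¹ h ≠ 0) (hb0 : ∀ k < 0, b k = 0) (hbR : ∀ k, ‖b k‖ ≤ R)
    (hbQ : ∀ k, 0 ≤ k → Polynomial.aeval (shiftEnd ℝ) Q b k = 0)
    (hbh : Polynomial.aeval (shiftEnd ℝ) h b 0 = 0) : b = 0 := by
  have hgeo := eq_mul_inv_pow_of_aeval_shiftEnd_eq_zero hθ hQ hs hbR hbQ
  have hzero : b 0 * Polynomial.aeval θ⁻¹ h = 0 := by
    rw [← hbh, aeval_shiftEnd_apply, Polynomial.aeval_eq_sum_range, Finset.mul_sum]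
    simp only [zero_add, hgeo, mul_smul_comm]
  ext k
  rcases le_or_gt 0 k with hk | hk
  · lift k to ℕ using hk
    rw [hgeo k, (mul_eq_zero.1 hzero).resolve_right hh, zero_mul, Pi.zero_apply]
  · exact hb0 k hk

theorem countable_halfSeqs {θ : ℝ} (hθ : θ ≠ 0) {s : Multiset ℂ}
    (hQ : Q.map (algebraMap ℤ ℂ) = reciprocalPoly ((θ : ℂ) ::ₘ s)) (hs : ∀ α ∈ s, ‖α‖ < 1)
    (hh : Polynomial.aeval θ⁻¹ h ≠ 0) (R : ℝ) (M : ℕ) : (halfSeqs Q h R M).Countable := by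
  have hsub (p : (ℤ →₀ ℤ) × ℤ) : {e ∈ halfSeqs Q h R M |
      (∀ k, 0 ≤ k → Polynomial.aeval (shiftEnd ℝ) Q e k = p.1 k) ∧
        Polynomial.aeval (shiftEnd ℝ) h e 0 = p.2}.Subsingleton := by
    rintro e ⟨he, heQ, heh⟩ e' ⟨he', heQ', heh'⟩
    obtain ⟨hb0, hbR, -⟩ := sub_mem_halfSeqs he he'
    refine sub_eq_zero.1 (eq_zero_of_aeval_shiftEnd_eq_zero hθ hQ hs hh hb0 hbR ?_ ?_)
    · intro k hk
      simp [heQ k hk, heQ' k hk]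
    · simp [heh, heh']
  refine (countable_iUnion fun p => (hsub p).countable).mono fun e he => mem_iUnion.2 ?_
  obtain ⟨c, -, -, hc⟩ := he.2.2.1
  obtain ⟨m, hm⟩ := he.2.2.2
  exact ⟨(c, m), he, hc, hm⟩

theorem tendsto_aeval_shiftEnd {X : Type*} {l : Filter X} {e : X → ℤ → ℝ} {a : ℤ → ℝ}
    (he : ∀ k, Tendsto (fun x => e x k) l (𝓝 (a k))) (P : Polynomial ℤ) (k : ℤ) :
    Tendsto (fun x => Polynomial.aeval (shiftEnd ℝ) P (e x) k) l
      (𝓝 (Polynomial.aeval (shiftEnd ℝ) P a k)) := by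
  simp only [aeval_shiftEnd_apply]
  exact tendsto_finsetSum _ fun i _ => (he _).const_smul _

theorem exists_mem_halfSeqs_tendsto {X : Type*} {u : Ultrafilter X} {e : X → ℤ → ℝ}
    (he : ∀ᶠ x in u, e x ∈ halfSeqs Q h R M) :
    ∃ a ∈ halfSeqs Q h R M, ∀ k, Tendsto (fun x => e x k) u (𝓝 (a k)) := by
  have hlim (k : ℤ) : ∃ y ∈ Metric.closedBall 0 R, Tendsto (fun x => e x k) u (𝓝 y) :=
    (isCompact_closedBall 0 R).ultrafilter_le_nhds (u.map fun x => e x k)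
      (le_principal_iff.2 (he.mono fun x hx => mem_closedBall_zero_iff.2 (hx.2.1 k)))
  choose a haR ha using hlim
  choose! d hdM hd0 hd using fun x (hx : e x ∈ halfSeqs Q h R M) => hx.2.2.1
  obtain ⟨c, hcM, hc⟩ := exists_finsupp_eventually_eq (he.mono hdM)
  refine ⟨a, ⟨fun k hk => ?_, fun k => mem_closedBall_zero_iff.1 (haR k),
    ⟨c, hcM, fun k hk => ?_, fun k hk => ?_⟩, ?_⟩, ha⟩
  · exact tendsto_nhds_unique (ha k) (tendsto_const_nhds.congr' (he.mono fun x hx =>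
      (hx.1 k hk).symm))
  · obtain ⟨x, hx, hxc⟩ := (he.and (hc k)).exists
    rw [← hxc, hd0 x hx k hk]
  · refine tendsto_nhds_unique (tendsto_aeval_shiftEnd ha Q k) (tendsto_const_nhds.congr' ?_)
    filter_upwards [he, hc k] with x hx hxc
    rw [hd x hx k hk, hxc]
  · obtain ⟨m, hm⟩ := Int.isClosedEmbedding_coe_real.isClosed_range.mem_of_tendsto
      (tendsto_aeval_shiftEnd ha h 0) (he.mono fun x hx => hx.2.2.2.imp fun m hm => hm.symm)
    exact ⟨m, hm.symm⟩

theorem mem_image2_blockValue_of_tendsto (hg : Summable fun k => ‖g k‖)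
    (hgreen : Polynomial.aeval (shiftEnd ℝ) Q g = Pi.single 0 1) {X : Type*} {u : Ultrafilter X}
    {e : X → ℤ → ℝ} (he : ∀ᶠ x in u, e x ∈ halfSeqs Q h R M) {z : ℝ}
    (hz : Tendsto (fun x => blockValue (e x)) u (𝓝 z)) :
    z ∈ image2 (fun a y => blockValue a * y) (halfSeqs Q h R M) (blockMonoid g) := by
  obtain ⟨a, ha, hlim⟩ := exists_mem_halfSeqs_tendsto he
  have hb : ∀ᶠ x in u, e x - a ∈ halfSeqs Q h (R + R) (M + M) :=
    he.mono fun x hx => sub_mem_halfSeqs hx ha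
  have hb0 (k : ℤ) : Tendsto (fun x => (e x - a) k) u (𝓝 0) := by
    simpa using (hlim k).sub_const (a k)
  have hbs := hb.mono fun x hx => summable_norm_of_mem_halfSeqs hg hgreen hx
  obtain ⟨y, hy⟩ := exists_tendsto_blockValue hbs
  choose! d hdM hd using fun x (hx : e x - a ∈ halfSeqs Q h (R + R) (M + M)) =>
    exists_abs_blockValue_sub_convBlockValue_le hg hgreen hx
  have herr : Tendsto (fun x => blockValue (e x - a) - convBlockValue g (d x)) u (𝓝 0) := by
    refine squeeze_zero_norm' (hb.mono hd) ?_
    rw [show (0 : ℝ) = π * ((∑' k, ‖g k‖) * ∑ k ∈ Finset.Ico (-(Q.natDegree : ℤ)) 0,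
      ‖Polynomial.aeval (shiftEnd ℝ) Q (0 : ℤ → ℝ) k‖) by simp]
    exact ((tendsto_finsetSum _ fun k _ => (tendsto_aeval_shiftEnd hb0 Q k).norm).const_mul
      _).const_mul _
  have hdy : Tendsto (fun x => convBlockValue g (d x)) u (𝓝 y) := by
    simpa using hy.sub herr
  have hprod := tendsto_blockValue_add_sub_mul (summable_norm_of_mem_halfSeqs hg hgreen ha) hbs hb0
  simp only [add_sub_cancel] at hprod
  exact ⟨a, ha, y, mem_blockMonoid_of_tendsto hg (hb.mono hdM) hdy,
    (sub_eq_zero.1 (tendsto_nhds_unique (hz.sub (hy.const_mul _)) hprod)).symm⟩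

end HalfSeqs

/-! ### Countability of the closure of the set of values -/

/-- The signed distances of `2 t θ⁻ᵏ`, `k ≥ 0`, to the nearest integers, extended by zero. -/
noncomputable def distSeq (θ t : ℝ) (k : ℤ) : ℝ :=
  if 0 ≤ k then 2 * t * θ⁻¹ ^ k.toNat - round (2 * t * θ⁻¹ ^ k.toNat) else 0

theorem distSeq_natCast (θ t : ℝ) (n : ℕ) :
    distSeq θ t n = 2 * t * θ⁻¹ ^ n - round (2 * t * θ⁻¹ ^ n) := by
  simp [distSeq]

theorem distSeq_of_neg (θ t : ℝ) {k : ℤ} (hk : k < 0) : distSeq θ t k = 0 :=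
  if_neg hk.not_ge

theorem norm_distSeq_le (θ t : ℝ) (k : ℤ) : ‖distSeq θ t k‖ ≤ 1 / 2 := by
  unfold distSeq
  split_ifs
  · exact abs_sub_round _
  · norm_num

theorem summable_norm_distSeq {θ : ℝ} (hθ : 1 < θ) (t : ℝ) :
    Summable fun k => ‖distSeq θ t k‖ := by
  refine Summable.of_nat_of_neg_add_one ?_ ?_
  · refine ((summable_inv_pow hθ).mul_left (2 * t)).abs.of_nonneg_of_le
      (fun _ => norm_nonneg _) fun n => ?_
    rw [distSeq_natCast, inv_pow]
    simpa using round_le (2 * t * (θ ^ n)⁻¹) 0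
  · refine summable_zero.congr fun n => ?_
    rw [distSeq_of_neg θ t (by omega), norm_zero]

theorem blockValue_distSeq {θ : ℝ} (hθ : 1 < θ) (t : ℝ) :
    blockValue (distSeq θ t) = |bernoulliFourier θ t| := by
  have hdist := (summableModOne_div_two (summable_norm_distSeq hθ t)).multipliable_cos
  have hsupp : Function.mulSupport (fun k : ℤ => ‖Real.cos (2 * π * (distSeq θ t k / 2))‖) ⊆
      range ((↑) : ℕ → ℤ) := fun k hk => by
    by_contra hneg
    have hlt : k < 0 := not_le.1 fun h0 => hneg ⟨k.toNat, Int.toNat_of_nonneg h0⟩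
    simp [distSeq_of_neg θ t hlt] at hk
  rw [blockValue, bernoulliFourier, cosProd, cosProd, ← Real.norm_eq_abs, ← Real.norm_eq_abs,
    hdist.norm_tprod, (summableModOne_mul_inv_pow hθ t).multipliable_cos.norm_tprod,
    ← Nat.cast_injective.tprod_eq hsupp]
  refine tprod_congr fun n => ?_
  have harg : 2 * π * (distSeq θ t n / 2) =
      2 * π * (t * (θ ^ n)⁻¹) - round (2 * t * θ⁻¹ ^ n) * π := by
    rw [distSeq_natCast, inv_pow]
    ring
  rw [harg, Real.cos_sub_int_mul_pi, norm_mul]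
  simp

theorem aeval_shiftEnd_distSeq (P : Polynomial ℤ) (θ t : ℝ) (n : ℕ) :
    ∃ m : ℤ, Polynomial.aeval (shiftEnd ℝ) P (distSeq θ t) n =
      2 * t * θ⁻¹ ^ n * Polynomial.aeval θ⁻¹ P + m := by
  refine ⟨-∑ i ∈ Finset.range (P.natDegree + 1), P.coeff i * round (2 * t * θ⁻¹ ^ (n + i)), ?_⟩
  rw [aeval_shiftEnd_apply, Polynomial.aeval_eq_sum_range, Finset.mul_sum]
  push_cast
  rw [← sub_eq_add_neg, ← Finset.sum_sub_distrib]
  refine Finset.sum_congr rfl fun i _ => ?_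
  rw [← Nat.cast_add, distSeq_natCast, zsmul_eq_mul, zsmul_eq_mul, pow_add]
  ring

theorem abs_cos_pi_mul_le {x : ℝ} (hx : |x| ≤ 1 / 2) :
    |Real.cos (π * x)| ≤ Real.exp (-(2 * x ^ 2)) := by
  have hpi := Real.pi_pos
  have habs : |π * x| ≤ π / 2 := by
    rw [abs_mul, abs_of_pos hpi]
    nlinarith
  have hcos := Real.cos_le_one_sub_mul_cos_sq (x := π * x) (by linarith)
  have hsq : 2 / π ^ 2 * (π * x) ^ 2 = 2 * x ^ 2 := by field_simp
  rw [abs_of_nonneg (Real.cos_nonneg_of_mem_Icc (abs_le.1 habs))]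
  linarith [Real.add_one_le_exp (-(2 * x ^ 2))]

theorem sum_sq_le_of_le_blockValue {e : ℤ → ℝ} (he : Summable fun k => ‖e k‖)
    (hhalf : ∀ k, ‖e k‖ ≤ 1 / 2) {δ : ℝ} (hδ : 0 < δ) (h : δ ≤ blockValue e) (F : Finset ℤ) :
    ∑ k ∈ F, e k ^ 2 ≤ -Real.log δ / 2 := by
  have hexp : δ ≤ Real.exp (-(2 * ∑ k ∈ F, e k ^ 2)) := by
    refine h.trans ((norm_tprod_le_norm_prod (summableModOne_div_two he).multipliable_cos
      (fun _ => Real.abs_cos_le_one _) F).trans ?_)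
    rw [Finset.mul_sum, ← Finset.sum_neg_distrib, Real.exp_sum, norm_prod]
    refine Finset.prod_le_prod (fun _ _ => norm_nonneg _) fun k _ => ?_
    rw [mul_assoc, mul_left_comm, mul_div_cancel₀ _ two_ne_zero]
    exact abs_cos_pi_mul_le (hhalf k)
  have hlog := Real.log_le_log hδ hexp
  rw [Real.log_exp] at hlog
  linarith

theorem sum_sq_aeval_shiftEnd_le (Q : Polynomial ℤ) {e : ℤ → ℝ} {C : ℝ}
    (h : ∀ F : Finset ℤ, ∑ k ∈ F, e k ^ 2 ≤ C) (F : Finset ℤ) :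
    ∑ k ∈ F, Polynomial.aeval (shiftEnd ℝ) Q e k ^ 2 ≤
      (∑ i ∈ Finset.range (Q.natDegree + 1), (Q.coeff i : ℝ) ^ 2) * ((Q.natDegree + 1) * C) := by
  simp only [aeval_shiftEnd_apply, zsmul_eq_mul]
  refine (Finset.sum_le_sum fun k _ => Finset.sum_mul_sq_le_sq_mul_sq _ _ _).trans ?_
  rw [← Finset.mul_sum, Finset.sum_comm]
  refine mul_le_mul_of_nonneg_left ?_ (Finset.sum_nonneg fun _ _ => sq_nonneg _)
  refine (Finset.sum_le_card_nsmul _ _ C fun i _ => ?_).trans_eq (by simp)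
  simpa using h (F.map (Equiv.addRight (i : ℤ)).toEmbedding)

theorem exists_finsupp_of_sum_sq_le {f : ℤ → ℝ} (hint : ∀ k, 0 ≤ k → ∃ m : ℤ, f k = m) {M : ℕ}
    (hf : ∀ F : Finset ℤ, ∑ k ∈ F, f k ^ 2 ≤ M) :
    ∃ c : ℤ →₀ ℤ, absSum c ≤ M ∧ (∀ k < 0, c k = 0) ∧ ∀ k, 0 ≤ k → f k = c k := by
  choose! m hm using hint
  have habs (k : ℤ) : ((if 0 ≤ k then m k else 0).natAbs : ℝ) ≤ f k ^ 2 := by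
    split_ifs with hk
    · rw [hm k hk, Nat.cast_natAbs]
      exact_mod_cast Int.natAbs_le_self_sq (m k)
    · simpa using sq_nonneg (f k)
  obtain ⟨c, hcM, hc⟩ := exists_finsupp_of_sum_natAbs_le
    (c := fun k => if 0 ≤ k then m k else 0) (M := M) fun s => by
      refine Nat.cast_le (α := ℝ).1 ?_
      rw [Nat.cast_sum]
      exact (Finset.sum_le_sum fun k _ => habs k).trans (hf s)
  exact ⟨c, hcM, fun k hk => by simp [hc, hk.not_ge], fun k hk => by simp [hc, hk, hm k hk]⟩

theorem distSeq_mem_halfSeqs {θ : ℝ} (hθ : 1 < θ) {Q : Polynomial ℤ}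
    (hQ : Polynomial.aeval θ⁻¹ Q = 0) (h : Polynomial ℤ) {δ : ℝ} (hδ : 0 < δ) :
    ∃ M : ℕ, ∀ t, δ ≤ |bernoulliFourier θ t| → (∃ m : ℤ, 2 * t * Polynomial.aeval θ⁻¹ h = m) →
      distSeq θ t ∈ halfSeqs Q h (1 / 2) M := by
  obtain ⟨M, hM⟩ := exists_nat_ge ((∑ i ∈ Finset.range (Q.natDegree + 1), (Q.coeff i : ℝ) ^ 2) *
    ((Q.natDegree + 1) * (-Real.log δ / 2)))
  refine ⟨M, fun t ht ⟨m, hm⟩ => ⟨fun k hk => distSeq_of_neg θ t hk, norm_distSeq_le θ t, ?_, ?_⟩⟩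
  · rw [← blockValue_distSeq hθ] at ht
    refine exists_finsupp_of_sum_sq_le (fun k hk => ?_) fun F => (sum_sq_aeval_shiftEnd_le Q
      (sum_sq_le_of_le_blockValue (summable_norm_distSeq hθ t) (norm_distSeq_le θ t) hδ ht) F).trans
        hM
    lift k to ℕ using hk
    simpa [hQ] using aeval_shiftEnd_distSeq Q θ t k
  · obtain ⟨n, hn⟩ := aeval_shiftEnd_distSeq h θ t 0
    exact ⟨m + n, by simpa [hm] using hn⟩

section Countable

variable {θ : ℝ} {Q h : Polynomial ℤ} {g : ℤ → ℝ}

theorem exists_abs_mem_image2_of_mem_closure (hθ : 1 < θ) (hQ : Polynomial.aeval θ⁻¹ Q = 0)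
    (hg : Summable fun k => ‖g k‖) (hgreen : Polynomial.aeval (shiftEnd ℝ) Q g = Pi.single 0 1)
    {z : ℝ} (hz0 : z ≠ 0) (hz : z ∈ closure
      (bernoulliFourier θ '' {t | ∃ m : ℤ, 2 * t * Polynomial.aeval θ⁻¹ h = m})) :
    ∃ M, |z| ∈ image2 (fun a y => blockValue a * y) (halfSeqs Q h (1 / 2) M) (blockMonoid g) := by
  have hz' : 0 < |z| := abs_pos.2 hz0
  obtain ⟨M, hM⟩ := distSeq_mem_halfSeqs hθ hQ h (half_pos hz')
  rw [mem_closure_iff_clusterPt, ← map_principal] at hz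
  obtain ⟨t, htm, ht⟩ := mapClusterPt_iff_ultrafilter.1 hz
  rw [le_principal_iff] at htm
  refine ⟨M, mem_image2_blockValue_of_tendsto hg hgreen (e := distSeq θ) (u := t) ?_ ?_⟩
  · filter_upwards [ht.abs.eventually_const_le (half_lt_self hz'), htm] with x hx hxm using
      hM x hx hxm
  · simpa only [blockValue_distSeq hθ] using ht.abs

theorem IsPisot.countable_closure_image_bernoulliFourier (hθ : IsPisot θ)
    (hh : Polynomial.aeval θ⁻¹ h ≠ 0) : (closure
      (bernoulliFourier θ '' {t | ∃ m : ℤ, 2 * t * Polynomial.aeval θ⁻¹ h = m})).Countable := by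
  have hθ1 := hθ.1
  obtain ⟨Q, s, hQ, hQ0, hs⟩ := hθ.exists_map_eq_reciprocalPoly
  obtain ⟨g, hg, hgreen⟩ := exists_green_of_map_eq_reciprocalPoly hQ fun α hα => by
    rcases Multiset.mem_cons.1 hα with rfl | hα
    · simpa [abs_of_pos (zero_lt_one.trans hθ1)] using hθ1.ne'
    · exact (hs α hα).ne
  set S : Set ℝ := insert 0 (⋃ M, image2 (fun a y => blockValue a * y)
    (halfSeqs Q h (1 / 2) M) (blockMonoid g))
  have hS : S.Countable := (countable_iUnion fun M => (countable_halfSeqs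
    (zero_lt_one.trans hθ1).ne' hQ hs hh _ M).image2 (countable_blockMonoid g) _).insert 0
  refine (hS.union (hS.image Neg.neg)).mono fun z hz => ?_
  have hzS : |z| ∈ S := by
    rcases eq_or_ne z 0 with rfl | hz0
    · exact Or.inl abs_zero
    · exact Or.inr (mem_iUnion.2 (exists_abs_mem_image2_of_mem_closure hθ1 hQ0 hg hgreen hz0 hz))
  rcases abs_choice z with h | h
  · exact Or.inl (h ▸ hzS)
  · exact Or.inr ⟨|z|, hzS, by rw [h, neg_neg]⟩

theorem IsPisot.countable_closure_range {r : ℝ} (hθ : IsPisot θ) (hr : r ≠ 0)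
    (hrmem : r ∈ IntermediateField.adjoin ℚ {θ}) :
    (closure (range fun n : ℤ => bernoulliFourier θ (r * n))).Countable := by
  obtain ⟨D, hD, h, hh⟩ := exists_natCast_mul_eq_aeval hθ.isIntegral_rat.inv.isAlgebraic
    (inv_mem_adjoin_inv hrmem)
  have hh0 : Polynomial.aeval θ⁻¹ h ≠ 0 := by
    rw [← hh]
    positivity
  refine (hθ.countable_closure_image_bernoulliFourier hh0).mono (closure_mono ?_)
  rintro _ ⟨n, rfl⟩
  refine mem_image_of_mem _ ⟨2 * n * D, ?_⟩
  rw [← hh]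
  push_cast
  field_simp

end Countable

/-! ### Cluster points -/

section ClusterPoints

variable {X Y ι : Type*} [TopologicalSpace X] [TopologicalSpace Y]

theorem derivedSet_image_of_isClosedEmbedding {e : X → Y} (he : IsClosedEmbedding e) (s : Set X) :
    derivedSet (e '' s) = e '' derivedSet s := by
  refine Subset.antisymm (fun y hy => ?_) (he.continuous.image_derivedSet he.injective)
  obtain ⟨x, rfl⟩ := closure_minimal (image_subset_range e s) he.isClosed_range
    (derivedSet_subset_closure _ hy)
  refine mem_image_of_mem e ?_
  rwa [mem_derivedSet, accPt_principal_iff_clusterPt, ← image_singleton,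
    ← image_sdiff he.injective, ← map_principal, ← mapClusterPt_def,
    he.isInducing.mapClusterPt_iff, ← accPt_principal_iff_clusterPt] at hy

theorem setOf_mapClusterPt_subset {f : ι → X} {K : Set X} (hK : IsClosed K) (hf : ∀ i, f i ∈ K)
    (l : Filter ι) : {x | MapClusterPt x l f} ⊆ K := fun _ hx =>
  hK.closure_subset (mem_closure_iff_clusterPt.2
    (ClusterPt.mono hx (le_principal_iff.2 (mem_map.2 (univ_mem' hf)))))

theorem setOf_mapClusterPt_comp_of_isClosedEmbedding {e : X → Y} (he : IsClosedEmbedding e)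
    (f : ι → X) (l : Filter ι) :
    {y | MapClusterPt y l (e ∘ f)} = e '' {x | MapClusterPt x l f} := by
  have hiff (x : X) : MapClusterPt (e x) l (e ∘ f) ↔ MapClusterPt x l f := by
    rw [mapClusterPt_comp, he.isInducing.mapClusterPt_iff, mapClusterPt_def]
  refine Subset.antisymm (fun y hy => ?_) (image_subset_iff.2 fun x hx => (hiff x).2 hx)
  obtain ⟨x, rfl⟩ := setOf_mapClusterPt_subset he.isClosed_range
    (fun i => mem_range_self (f i)) l hy
  exact mem_image_of_mem e ((hiff x).1 hy)

theorem derivedSet_range_subset_setOf_mapClusterPt [T1Space X] (f : ι → X) :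
    derivedSet (range f) ⊆ {x | MapClusterPt x cofinite f} := by
  intro x hx
  have hle : cofinite ⊓ 𝓟 (range f) ≤ map f cofinite := fun s hs => by
    rw [mem_inf_principal, mem_cofinite]
    refine (Set.Finite.image f (mem_cofinite.1 (mem_map.1 hs))).subset ?_
    rintro y hy
    obtain ⟨⟨i, rfl⟩, hi⟩ : y ∈ range f ∧ y ∉ s := by simpa using hy
    exact ⟨i, hi, rfl⟩
  refine NeBot.mono (f := 𝓝[≠] x ⊓ 𝓟 (range f)) hx (le_inf (inf_le_left.trans inf_le_left) ?_)
  exact (inf_le_inf_right _ (nhdsNE_le_cofinite x)).trans hle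

theorem derivedSet_range_mul_intCast_subset [T1Space X] {f : ℝ → X} (heven : ∀ t, f (-t) = f t)
    {r : ℝ} (hr : r ≠ 0) :
    derivedSet (range fun n : ℤ => f (r * n)) ⊆ {x | MapClusterPt x atTop f} := by
  have habs : (fun n : ℤ => f (r * n)) = f ∘ fun n : ℤ => |r| * |(n : ℝ)| := by
    funext n
    rw [Function.comp_apply, ← abs_mul]
    rcases abs_choice (r * n) with h | h <;> rw [h]
    rw [heven]
  have htop : Tendsto (fun n : ℤ => |r| * |(n : ℝ)|) cofinite atTop :=
    (tendsto_norm_cocompact_atTop.comp Int.tendsto_coe_cofinite).const_mul_atTop (abs_pos.2 hr)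
  rw [habs]
  exact (derivedSet_range_subset_setOf_mapClusterPt _).trans
    fun x hx => MapClusterPt.of_comp htop hx

theorem ordConnected_setOf_mapClusterPt_atTop {f : ℝ → ℝ} (hf : Continuous f) :
    OrdConnected {x | MapClusterPt x atTop f} := by
  simp only [mapClusterPt_atTop_iff_forall_mem_closure, ofPred_forall]
  exact ordConnected_iInter fun T =>
    (isPreconnected_Ici.image f hf.continuousOn).closure.ordConnected

theorem exists_setOf_mapClusterPt_atTop_eq_Icc {f : ℝ → ℝ} (hf : Continuous f) {K : Set ℝ}
    (hK : IsCompact K) (hfK : ∀ t, f t ∈ K) {x y : ℝ} (hx : MapClusterPt x atTop f)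
    (hy : MapClusterPt y atTop f) (hxy : x ≠ y) :
    ∃ a b, a < b ∧ {z | MapClusterPt z atTop f} = Icc a b := by
  have hcompact : IsCompact {z | MapClusterPt z atTop f} := hK.of_isClosed_subset
    isClosed_setOfPred_clusterPt (setOf_mapClusterPt_subset hK.isClosed hfK atTop)
  have hJ := eq_Icc_of_connected_compact
    ⟨⟨x, hx⟩, (ordConnected_setOf_mapClusterPt_atTop hf).isPreconnected⟩ hcompact
  refine ⟨_, _, lt_of_not_ge fun hle => hxy ?_, hJ⟩
  exact subsingleton_Icc_of_ge hle (hJ.subset hx) (hJ.subset hy)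

end ClusterPoints

/-! ### Almost every dilation -/

theorem ae_frequently_exists_abs_mul_sub_intCast_lt {t : ℕ → ℝ} (ht : Tendsto t atTop atTop) :
    ∀ᵐ u : ℝ, ∀ δ > 0, ∃ᶠ j in atTop, ∃ n : ℤ, |u * t j - n| < δ := by
  set s : ℕ → Set ℝ := fun j => range fun n : ℤ => n / t j
  have hmem {u δ : ℝ} {j : ℕ} (hj : 0 < t j) :
      u ∈ Metric.thickening (δ * (t j)⁻¹) (s j) ↔ ∃ n : ℤ, |u * t j - n| < δ := by
    have heq (n : ℤ) : u - n / t j = (u * t j - n) / t j := by field_simp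
    simp only [s, Metric.mem_thickening_iff, exists_range_iff, Real.dist_eq, heq, abs_div,
      abs_of_pos hj, ← div_eq_mul_inv, div_lt_div_iff_of_pos_right hj]
  have hscale (m : ℕ) := (blimsup_thickening_mul_ae_eq volume (fun _ => True) s
    (Nat.one_div_pos_of_nat (α := ℝ) (n := m)) (fun j => (t j)⁻¹) ht.inv_tendsto_atTop).mem_iff
  filter_upwards [ae_all_iff.2 hscale] with u hu δ hδ
  simp only [blimsup_true, mem_limsup_iff_frequently_mem] at hu
  have hpos := ht.eventually_gt_atTop 0
  have hone : ∃ᶠ j in atTop, u ∈ Metric.thickening (t j)⁻¹ (s j) := by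
    refine (hpos.mono fun j hj => ?_).frequently
    rw [← one_mul (t j)⁻¹, hmem hj]
    exact ⟨round (u * t j), (abs_sub_round _).trans_lt one_half_lt_one⟩
  obtain ⟨m, hm⟩ := exists_nat_one_div_lt hδ
  refine (((hu m).2 hone).and_eventually hpos).mono fun j ⟨hj, hj0⟩ => ?_
  obtain ⟨n, hn⟩ := (hmem hj0).1 hj
  exact ⟨n, hn.trans hm⟩

theorem ae_comp_inv {p : ℝ → Prop} (hp : ∀ᵐ u : ℝ, p u) : ∀ᵐ r : ℝ, p r⁻¹ := by
  have hnull : volume (Inv.inv '' ({u : ℝ | ¬ p u} \ {0})) = 0 :=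
    addHaar_image_eq_zero_of_differentiableOn_of_addHaar_eq_zero volume
      (fun u hu => (differentiableAt_inv hu.2).differentiableWithinAt)
      (measure_mono_null sdiff_subset hp)
  filter_upwards [measure_eq_zero_iff_ae_notMem.1 hnull, compl_mem_ae_iff.2 (measure_singleton 0)]
    with r hr hr0
  by_contra h
  exact hr ⟨r⁻¹, ⟨h, inv_ne_zero hr0⟩, inv_inv r⟩

theorem ae_exists_abs_mul_intCast_sub_lt {t : ℕ → ℝ} (ht : Tendsto t atTop atTop) :
    ∀ᵐ r : ℝ, ∀ δ > 0, ∃ j, ∃ n : ℤ, |r * n - t j| < δ := by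
  filter_upwards [ae_comp_inv (ae_frequently_exists_abs_mul_sub_intCast_lt ht),
    compl_mem_ae_iff.2 (measure_singleton 0)] with r hr hr0 δ hδ
  have hr' : 0 < |r| := abs_pos.2 hr0
  obtain ⟨j, n, hn⟩ := (hr (δ / |r|) (by positivity)).exists
  refine ⟨j, n, ?_⟩
  rwa [lt_div_iff₀ hr', ← abs_mul, sub_mul, mul_right_comm, inv_mul_cancel₀ hr0, one_mul,
    abs_sub_comm, mul_comm] at hn

section Dilation

variable {X : Type*} [PseudoMetricSpace X] {f : ℝ → X}

theorem ae_mem_closure_range_mul_intCast (hf : UniformContinuous f) {z : X}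
    (hz : MapClusterPt z atTop f) :
    ∀ᵐ r : ℝ, z ∈ closure (range fun n : ℤ => f (r * n)) := by
  have hsingle (m : ℕ) : ∀ᵐ r : ℝ, ∃ n : ℤ, dist z (f (r * n)) < 2 * (1 / (m + 1 : ℝ)) := by
    have hm : 0 < 1 / (m + 1 : ℝ) := Nat.one_div_pos_of_nat
    obtain ⟨t, ht, hzt⟩ := exists_seq_forall_of_frequently
      (hz.frequently (Metric.ball_mem_nhds z hm))
    obtain ⟨δ, hδ, hfδ⟩ := Metric.uniformContinuous_iff.1 hf _ hm
    filter_upwards [ae_exists_abs_mul_intCast_sub_lt ht] with r hr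
    obtain ⟨j, n, hn⟩ := hr δ hδ
    refine ⟨n, (dist_triangle_right _ _ (f (t j))).trans_lt ?_⟩
    rw [two_mul]
    exact add_lt_add (Metric.mem_ball'.1 (hzt j)) (hfδ hn)
  filter_upwards [ae_all_iff.2 hsingle] with r hr
  refine Metric.mem_closure_range_iff.2 fun ε hε => ?_
  obtain ⟨m, hm⟩ := exists_nat_one_div_lt (half_pos hε)
  obtain ⟨n, hn⟩ := hr m
  exact ⟨n, by linarith⟩

theorem ae_setOf_mapClusterPt_subset_closure_range [SecondCountableTopology X]
    (hf : UniformContinuous f) :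
    ∀ᵐ r : ℝ, {z | MapClusterPt z atTop f} ⊆ closure (range fun n : ℤ => f (r * n)) := by
  obtain ⟨c, hcJ, hc, hJc⟩ := (TopologicalSpace.IsSeparable.of_separableSpace
    {z | MapClusterPt z atTop f}).exists_countable_dense_subset
  filter_upwards [(ae_ball_iff hc).2 fun z hz => ae_mem_closure_range_mul_intCast hf (hcJ hz)]
    with r hr
  exact hJc.trans (closure_minimal hr isClosed_closure)

end Dilation

/-! ### The limit set of the Fourier transform -/

section LimitSet

variable {θ : ℝ}

theorem derivedSet_fourierValues_bernoulliConvolution (hθ : 1 < θ) (r : ℝ) :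
    derivedSet (fourierValues (bernoulliConvolution θ) r) =
      Complex.ofReal '' derivedSet (range fun n : ℤ => bernoulliFourier θ (r * n)) := by
  rw [← derivedSet_image_of_isClosedEmbedding Complex.isometry_ofReal.isClosedEmbedding,
    ← range_comp, fourierValues]
  exact congrArg (fun g => derivedSet (range g))
    (funext fun n : ℤ => fourierTransform_bernoulliConvolution hθ _)

theorem fourierLimitPoints_bernoulliConvolution (hθ : 1 < θ) :
    fourierLimitPoints (bernoulliConvolution θ) =
      Complex.ofReal '' {x | MapClusterPt x atTop (bernoulliFourier θ)} := by
  rw [fourierLimitPoints, funext (fourierTransform_bernoulliConvolution hθ)]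
  exact setOf_mapClusterPt_comp_of_isClosedEmbedding Complex.isometry_ofReal.isClosedEmbedding _ _

theorem mapClusterPt_zero_bernoulliFourier (hθ : 1 < θ) :
    MapClusterPt 0 atTop (bernoulliFourier θ) := by
  have hzero (n : ℕ) : bernoulliFourier θ (1 / 4 + n) = 0 := by
    have hcos : Real.cos (2 * π * ((1 / 4 + n) * (θ ^ 0)⁻¹)) = 0 := by
      rw [pow_zero, inv_one, mul_one, ← Real.cos_pi_div_two,
        ← Real.cos_add_nat_mul_two_pi (π / 2) n]
      ring_nf
    have hle := (summableModOne_mul_inv_pow hθ (1 / 4 + n)).abs_cosProd_le_abs_cos 0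
    rwa [hcos, abs_zero, abs_nonpos_iff] at hle
  have htop : Tendsto (fun n : ℕ => 1 / 4 + (n : ℝ)) atTop atTop :=
    tendsto_atTop_add_const_left _ _ tendsto_natCast_atTop_atTop
  refine MapClusterPt.of_comp htop (Tendsto.mapClusterPt ?_)
  simpa only [Function.comp_def, hzero] using tendsto_const_nhds

theorem IsPisot.exists_mapClusterPt_bernoulliFourier_ne_zero (hθ : IsPisot θ) (hθ2 : θ ≠ 2) :
    ∃ w, MapClusterPt w atTop (bernoulliFourier θ) ∧ w ≠ 0 := by
  obtain ⟨d, hd, hne⟩ := hθ.exists_orbitCosProd_ne_zero hθ2 one_pos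
  have htop : Tendsto (fun N : ℕ => ((1 * d : ℕ) : ℝ) * θ ^ N) atTop atTop :=
    (tendsto_pow_atTop_atTop_of_one_lt hθ.1).const_mul_atTop (by positivity)
  exact ⟨_, MapClusterPt.of_comp htop (tendsto_bernoulliFourier_mul_pow hθ.1
    (hθ.natCast_mem_pisotModule _)).mapClusterPt, hne⟩

theorem IsPisot.exists_setOf_mapClusterPt_bernoulliFourier_eq_Icc (hθ : IsPisot θ) (hθ2 : θ ≠ 2) :
    ∃ a b, a < b ∧ {x | MapClusterPt x atTop (bernoulliFourier θ)} = Icc a b := by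
  obtain ⟨w, hw, hw0⟩ := hθ.exists_mapClusterPt_bernoulliFourier_ne_zero hθ2
  obtain ⟨K, hK⟩ := exists_lipschitzWith_bernoulliFourier hθ.1
  exact exists_setOf_mapClusterPt_atTop_eq_Icc hK.continuous isCompact_Icc
    (fun t => abs_le.1 (abs_bernoulliFourier_le_one hθ.1 t)) hw
    (mapClusterPt_zero_bernoulliFourier hθ.1) hw0

theorem ae_derivedSet_range_bernoulliFourier_eq (hθ : 1 < θ)
    (hperf : Preperfect {x | MapClusterPt x atTop (bernoulliFourier θ)}) :
    ∀ᵐ r : ℝ, derivedSet (range fun n : ℤ => bernoulliFourier θ (r * n)) =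
      {x | MapClusterPt x atTop (bernoulliFourier θ)} := by
  obtain ⟨K, hK⟩ := exists_lipschitzWith_bernoulliFourier hθ
  filter_upwards [ae_setOf_mapClusterPt_subset_closure_range hK.uniformContinuous,
    compl_mem_ae_iff.2 (measure_singleton 0)] with r hr hr0
  refine (derivedSet_range_mul_intCast_subset (bernoulliFourier_neg θ) hr0).antisymm ?_
  rw [← derivedSet_closure]
  exact (preperfect_iff_subset_derivedSet.1 hperf).trans (derivedSet_mono _ _ hr)

end LimitSet

theorem theorem2 (θ : ℝ) (hθ : IsPisot θ) (hθ2 : θ ≠ 2) :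
    (∀ r : ℝ, 0 < r → r ∈ IntermediateField.adjoin ℚ ({θ} : Set ℝ) →
      (derivedSet (fourierValues (bernoulliConvolution θ) r)).Countable ∧
      (derivedSet (fourierValues (bernoulliConvolution θ) r)).Infinite) ∧
    (∃ a b : ℝ, a < b ∧
      fourierLimitPoints (bernoulliConvolution θ) = Complex.ofReal '' Set.Icc a b ∧
      ∀ᵐ r : ℝ ∂(volume.restrict (Set.Ioi 0)),
        derivedSet (fourierValues (bernoulliConvolution θ) r) =
          fourierLimitPoints (bernoulliConvolution θ)) := by
  simp only [derivedSet_fourierValues_bernoulliConvolution hθ.1,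
    fourierLimitPoints_bernoulliConvolution hθ.1]
  refine ⟨fun r hr hrmem => ⟨?_, ?_⟩, ?_⟩
  · exact ((hθ.countable_closure_range hr.ne' hrmem).mono (derivedSet_subset_closure _)).image _
  · exact (hθ.infinite_derivedSet hθ2 hr.ne' hrmem).image Complex.ofReal_injective.injOn
  · obtain ⟨a, b, hab, hJ⟩ := hθ.exists_setOf_mapClusterPt_bernoulliFourier_eq_Icc hθ2
    have hperf : Preperfect (Icc a b) :=
      isPreconnected_Icc.preperfect_of_nontrivial
        ⟨a, left_mem_Icc.2 hab.le, b, right_mem_Icc.2 hab.le, hab.ne⟩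
    refine ⟨a, b, hab, congrArg _ hJ, ae_restrict_of_ae ?_⟩
    filter_upwards [ae_derivedSet_range_bernoulliFourier_eq hθ.1 (hJ ▸ hperf)] with r hr
    rw [hr]
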